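/- Let $E=(E^0,E^1,r,s)$ be a directed graph (of arbitrary cardinality) and let $k$ be a field. For a vertex $v$ let $T(v)$ be the set of vertices $w$ for which there is a path (possibly of length $0$) from $v$ to $w$. A vertex $v$ is a \emph{line point} if no vertex of $T(v)$ is the source of two or more edges and no vertex of $T(v)$ is the base point of a cycle (a path of length at least $1$ whose source equals its range). Let $L_k(E)$ be the Leavitt path algebra of $E$ over $k$, i.e. the universal $k$-algebra on generators $p_u$ ($u\in E^0$), $s_e,s_e^*$ ($e\in E^1$) with the usual relations, and let $C^*(E)$ be the graph $C^*$-algebra of $E$ (with the convention $s_e^*s_e=p_{r(e)}$, $s_es_e^*\le p_{s(e)}$). Suppose that $v\in E^0$ is a line point. Then $H:=T(v)$ is hereditary: if $e\in E^1$ and $s(e)\in H$, then $r(e)\in H$. Furthermore, let $\Lambda$ be the set of all finite paths $\alpha=e_1\cdots e_n$, $n\ge 0$, that end in $T(v)$ and that, if $n\geq 1$, satisfy $s(e_n)\notin T(v)$; that is, $$\Lambda := T(v)\ \cup\ \{ e_1\cdots e_n : n\ge 1,\ r(e_n)\in T(v),\ s(e_n)\notin T(v)\},$$ where the vertices in $T(v)$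 are regarded as paths of length $0$. Let $I_H$ be the two-sided ideal of $L_k(E)$ generated by $\{p_w : w\in H\}$, and let $\mathcal I_H$ be the closed two-sided ideal of $C^*(E)$ generated by $\{p_w : w\in H\}$. Then $$ I_H\cong M_\Lambda(k) \qquad\text{and}\qquad \mathcal I_H\cong \mathbb K(\ell^2(\Lambda)).$$ Here $M_\Lambda(k)$ is the algebra of $\Lambda\times\Lambda$ matrices over $k$ with only finitely many nonzero entries. The first isomorphism is one of $*$-algebras over $k$, where, for any chosen involution $c\mapsto\overline c$ of the field $k$ (for instance the trivial one), $L_k(E)$ carries the conjugate-linear involution that fixes each $p_w$ and exchanges $s_e$ and $s_e^*$, and $M_\Lambda(k)$ carries the conjugate transpose. The second is an isomorphism of $C^*$-algebras onto the compact operators on $\ell^2(\Lambda)$. -/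

import Mathlib

noncomputable section

open UniformSpace

/-! ### Directed graphs, paths and line points -/

/-- A directed graph with vertex set `V`, edge set `Ed`, range map `r` and source map `s`.
There is no restriction on the cardinalities. -/
structure DirGraph (V Ed : Type*) where
  r : Ed → V
  s : Ed → V

namespace DirGraph

variable {V Ed : Type*} (E : DirGraph V Ed)

/-- `E.IsPathFrom v [e₁, …, eₙ]`: either `n = 0`, or `s e₁ = v` and `r eᵢ = s eᵢ₊₁` for `i < n`. -/
def IsPathFrom : V → List Ed → Prop
  | _, [] => True
  | v, e :: l => E.s e = v ∧ IsPathFrom (E.r e) l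

/-- The vertex at which a list of edges starting at `v` ends. -/
def endVertex : V → List Ed → V
  | v, [] => v
  | _, e :: l => endVertex (E.r e) l

/-- Finite paths: a vertex (a path of length `0`, the case `edges = []`), or a sequence of
`n ≥ 1` composable edges, whose source is the source of the first edge. -/
@[ext] structure FinPath where
  source : V
  edges : List Ed
  isPath : E.IsPathFrom source edges

variable {E} in
/-- The range of a finite path. -/
def FinPath.range (α : E.FinPath) : V := E.endVertex α.source α.edges

/-- A cycle is a path of length at least one with equal source and range. -/
def IsCycle (α : E.FinPath) : Prop := α.edges ≠ [] ∧ α.source = α.range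

/-- `T(v)`: the vertices that can be reached from `v` by a path. -/
def reach (v : V) : Set V := {w | ∃ α : E.FinPath, α.source = v ∧ α.range = w}

/-- Hereditary sets of vertices. -/
def IsHereditary (H : Set V) : Prop := ∀ e : Ed, E.s e ∈ H → E.r e ∈ H

/-- A bifurcation vertex is the source of two or more edges. -/
def IsBifurcation (v : V) : Prop := ∃ e f : Ed, e ≠ f ∧ E.s e = v ∧ E.s f = v

/-- `v` is a line point: `T(v)` contains no bifurcation vertex and no base point of a cycle. -/
def IsLinePoint (v : V) : Prop :=
  (∀ w ∈ E.reach v, ¬ E.IsBifurcation w) ∧ ∀ α : E.FinPath, E.IsCycle α → α.source ∉ E.reach v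

/-- The paths `α` with range in `H` whose last edge, if `α` has an edge at all, has its source
outside `H`. So these are the vertices in `H` (as paths of length `0`) and the paths
`e₁ ⋯ eₙ`, `n ≥ 1`, with `r eₙ ∈ H` and `s eₙ ∉ H`. -/
def EntryPaths (H : Set V) : Type _ :=
  {α : E.FinPath // α.range ∈ H ∧ ∀ e ∈ α.edges.getLast?, E.s e ∉ H}

end DirGraph

/-! ### Two-sided ideals of (not necessarily unital) algebras -/

section Ideals

variable (k : Type*) {A : Type*} [CommRing k] [NonUnitalRing A] [Module k A]

/-- A subspace of an algebra is a two-sided ideal. -/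
def IsTwoSidedIdeal (J : Submodule k A) : Prop := ∀ a : A, ∀ x ∈ J, a * x ∈ J ∧ x * a ∈ J

/-- The two-sided ideal of the algebra `A` generated by `S`. -/
def idealSpan (S : Set A) : Submodule k A :=
  sInf {J | S ⊆ (J : Set A) ∧ IsTwoSidedIdeal k J}

variable {k}

theorem subset_idealSpan (S : Set A) : S ⊆ (idealSpan k S : Set A) := by
  intro x hx
  simp only [idealSpan, SetLike.mem_coe, Submodule.mem_sInf]
  exact fun J hJ => hJ.1 hx

theorem idealSpan_le {S : Set A} {J : Submodule k A} (h : S ⊆ (J : Set A))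
    (hJ : IsTwoSidedIdeal k J) : idealSpan k S ≤ J := sInf_le ⟨h, hJ⟩

theorem isTwoSidedIdeal_idealSpan (S : Set A) : IsTwoSidedIdeal k (idealSpan k S) := by
  intro a x hx
  simp only [idealSpan, Submodule.mem_sInf] at hx ⊢
  exact ⟨fun J hJ => (hJ.2 a x (hx J hJ)).1, fun J hJ => (hJ.2 a x (hx J hJ)).2⟩

/-- The image of a two-sided ideal under the involution, which is again a two-sided ideal. -/
def starIdeal [StarRing k] [StarRing A] [StarModule k A] (J : Submodule k A) :
    Submodule k A where
  carrier := {x | star x ∈ J}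
  add_mem' hx hy := by simpa using! J.add_mem hx hy
  zero_mem' := by simp
  smul_mem' c x hx := by simpa using! J.smul_mem (star c) hx

theorem isTwoSidedIdeal_starIdeal [StarRing k] [StarRing A] [StarModule k A]
    {J : Submodule k A} (hJ : IsTwoSidedIdeal k J) : IsTwoSidedIdeal k (starIdeal J) := by
  intro a x hx
  have := hJ (star a) (star x) hx
  exact ⟨by simpa [starIdeal] using this.2, by simpa [starIdeal] using this.1⟩

theorem star_mem_idealSpan [StarRing k] [StarRing A] [StarModule k A] {S : Set A}
    (hS : ∀ x ∈ S, star x ∈ S) {x : A} (hx : x ∈ idealSpan k S) : star x ∈ idealSpan k S :=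
  idealSpan_le (J := starIdeal (idealSpan k S))
    (fun y hy => subset_idealSpan S (hS y hy))
    (isTwoSidedIdeal_starIdeal (isTwoSidedIdeal_idealSpan S)) hx

end Ideals

/-! ### The free algebra on the generators -/

/-- The generators `p_v`, `s_e`, `s_e^*`. -/
inductive LPAGen (V Ed : Type*)
  | p (v : V)
  | s (e : Ed)
  | sStar (e : Ed)

/-- The involution of the set of generators. -/
def LPAGen.swap {V Ed : Type*} : LPAGen V Ed → LPAGen V Ed
  | .p v => .p v
  | .s e => .sStar e
  | .sStar e => .s e

@[simp] theorem LPAGen.swap_swap {V Ed : Type*} (g : LPAGen V Ed) : g.swap.swap = g := by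
  cases g <;> rfl

/-- The free (non-unital) associative `k`-algebra on the generators. -/
abbrev FreeGenAlg (k V Ed : Type*) [Field k] : Type _ :=
  MonoidAlgebra k (FreeSemigroup (LPAGen V Ed))

namespace FreeGenAlg

variable (k : Type*) {V Ed : Type*} [Field k]

/-- A generator, as an element of the free algebra. -/
def gen (g : LPAGen V Ed) : FreeGenAlg k V Ed := MonoidAlgebra.single (FreeSemigroup.of g) 1

/-- The involution of words: reverse the word and apply the involution to each letter. -/
def wordStar (w : FreeSemigroup (LPAGen V Ed)) : FreeSemigroup (LPAGen V Ed) :=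
  (FreeSemigroup.lift (fun g : LPAGen V Ed => MulOpposite.op (FreeSemigroup.of g.swap)) w).unop

theorem wordStar_of (g : LPAGen V Ed) :
    wordStar (FreeSemigroup.of g) = FreeSemigroup.of g.swap := by
  simp [wordStar]

theorem wordStar_mul (w z : FreeSemigroup (LPAGen V Ed)) :
    wordStar (w * z) = wordStar z * wordStar w := by
  simp [wordStar]

theorem wordStar_wordStar (w : FreeSemigroup (LPAGen V Ed)) : wordStar (wordStar w) = w := by
  induction w using FreeSemigroup.recOnMul with
  | ih1 g => simp [wordStar_of]
  | ih2 g w hg hw => simp only [wordStar_mul, hg, hw]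

variable {k} in
/-- The involution of the free algebra, semilinear with respect to the involution of `k`. -/
def starHom [StarRing k] : FreeGenAlg k V Ed →+ FreeGenAlg k V Ed :=
  (Finsupp.liftAddHom fun w =>
    (MonoidAlgebra.singleAddHom (wordStar w)).comp (starAddEquiv (R := k)).toAddMonoidHom).comp
    MonoidAlgebra.coeffAddEquiv.toAddMonoidHom

variable {k} in
theorem starHom_single [StarRing k] (w : FreeSemigroup (LPAGen V Ed)) (c : k) :
    starHom (MonoidAlgebra.single w c) = MonoidAlgebra.single (wordStar w) (star c) := by
  simp [starHom]

instance [StarRing k] : StarRing (FreeGenAlg k V Ed) where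
  star x := starHom x
  star_involutive x := by
    change starHom (starHom x) = x
    induction x using MonoidAlgebra.induction_linear with
    | zero => simp
    | add x y hx hy => simp [hx, hy]
    | single w c => simp [starHom_single, wordStar_wordStar]
  star_mul x y := by
    change starHom (x * y) = starHom y * starHom x
    induction x using MonoidAlgebra.induction_linear with
    | zero => simp
    | add x x' hx hx' => simp [hx, hx', add_mul, mul_add]
    | single w c =>
      induction y using MonoidAlgebra.induction_linear with
      | zero => simp
      | add y y' hy hy' => simp [hy, hy', add_mul, mul_add]
      | single z d =>
        simp [starHom_single, wordStar_mul, MonoidAlgebra.single_mul_single, mul_comm]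
  star_add x y := map_add starHom x y

theorem star_single [StarRing k] (w : FreeSemigroup (LPAGen V Ed)) (c : k) :
    star (MonoidAlgebra.single w c : FreeGenAlg k V Ed)
      = MonoidAlgebra.single (wordStar w) (star c) := starHom_single w c

theorem star_gen [StarRing k] (g : LPAGen V Ed) : star (gen k g) = gen k g.swap := by
  simp [gen, star_single, wordStar_of]

instance [StarRing k] : StarModule k (FreeGenAlg k V Ed) where
  star_smul c x := by
    induction x using MonoidAlgebra.induction_linear with
    | zero => simp
    | add x y hx hy => simp only [smul_add, star_add, hx, hy]
    | single w d => simp [MonoidAlgebra.smul_single, star_single]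

end FreeGenAlg

/-! ### Leavitt path algebras -/

open FreeGenAlg LPAGen in
/-- The relators of the Leavitt path algebra. In the last one `F` is the set `s⁻¹(v)`, for a
vertex `v` with `0 < |s⁻¹(v)| < ∞`. -/
inductive LPARelator (k : Type*) [Field k] {V Ed : Type*} (E : DirGraph V Ed) :
    FreeGenAlg k V Ed → Prop
  | idem (v) : LPARelator k E (gen k (p v) * gen k (p v) - gen k (p v))
  | orth (v w) (h : v ≠ w) : LPARelator k E (gen k (p v) * gen k (p w))
  | source_s (e) : LPARelator k E (gen k (p (E.s e)) * gen k (s e) - gen k (s e))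
  | s_range (e) : LPARelator k E (gen k (s e) * gen k (p (E.r e)) - gen k (s e))
  | range_sStar (e) : LPARelator k E (gen k (p (E.r e)) * gen k (sStar e) - gen k (sStar e))
  | sStar_source (e) : LPARelator k E (gen k (sStar e) * gen k (p (E.s e)) - gen k (sStar e))
  | sStar_s (e) : LPARelator k E (gen k (sStar e) * gen k (s e) - gen k (p (E.r e)))
  | sStar_s_ne (e f) (h : e ≠ f) : LPARelator k E (gen k (sStar e) * gen k (s f))
  | sum (v) (F : Finset Ed) (hne : F.Nonempty) (hF : ∀ e, e ∈ F ↔ E.s e = v) :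
      LPARelator k E (gen k (p v) - ∑ e ∈ F, gen k (s e) * gen k (sStar e))

section

variable (k : Type*) [Field k] {V Ed : Type*} (E : DirGraph V Ed)

/-- The two-sided ideal generated by the relators. -/
def lpaRelIdeal : Submodule k (FreeGenAlg k V Ed) := idealSpan k {x | LPARelator k E x}

/-- The Leavitt path algebra `L_k(E)`: the universal (non-unital) `k`-algebra on the generators
`p_v`, `s_e`, `s_e^*` with the Leavitt path algebra relations. -/
def LPA : Type _ := FreeGenAlg k V Ed ⧸ lpaRelIdeal k E

end

namespace LPA

variable (k : Type*) [Field k] {V Ed : Type*} (E : DirGraph V Ed)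

instance : AddCommGroup (LPA k E) := inferInstanceAs (AddCommGroup (_ ⧸ lpaRelIdeal k E))

instance : Module k (LPA k E) := inferInstanceAs (Module k (_ ⧸ lpaRelIdeal k E))

/-- The quotient map from the free algebra. -/
def mk : FreeGenAlg k V Ed →ₗ[k] LPA k E := (lpaRelIdeal k E).mkQ

theorem mk_surjective : Function.Surjective (mk k E) := (lpaRelIdeal k E).mkQ_surjective

theorem mk_eq_zero {x : FreeGenAlg k V Ed} : mk k E x = 0 ↔ x ∈ lpaRelIdeal k E :=
  Submodule.Quotient.mk_eq_zero _

theorem mk_eq_mk {x y : FreeGenAlg k V Ed} : mk k E x = mk k E y ↔ x - y ∈ lpaRelIdeal k E :=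
  Submodule.Quotient.eq _

instance : Mul (LPA k E) where
  mul a b := Quotient.liftOn₂' a b (fun x y => mk k E (x * y)) (by
    intro x y x' y' hx hy
    rw [Submodule.quotientRel_def] at hx hy
    rw [mk_eq_mk]
    have h1 := (isTwoSidedIdeal_idealSpan {x | LPARelator k E x} y _ hx).2
    have h2 := (isTwoSidedIdeal_idealSpan {x | LPARelator k E x} x' _ hy).1
    have h3 := (lpaRelIdeal k E).add_mem h1 h2
    have h4 : (x - x') * y + x' * (y - y') = x * y - x' * y' := by
      rw [sub_mul, mul_sub]; abel
    rwa [h4] at h3)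

theorem mk_mul (x y : FreeGenAlg k V Ed) : mk k E (x * y) = mk k E x * mk k E y := rfl

instance : NonUnitalRing (LPA k E) where
  left_distrib a b c := by
    obtain ⟨x, rfl⟩ := mk_surjective k E a
    obtain ⟨y, rfl⟩ := mk_surjective k E b
    obtain ⟨z, rfl⟩ := mk_surjective k E c
    simp only [← mk_mul, ← map_add, mul_add]
  right_distrib a b c := by
    obtain ⟨x, rfl⟩ := mk_surjective k E a
    obtain ⟨y, rfl⟩ := mk_surjective k E b
    obtain ⟨z, rfl⟩ := mk_surjective k E c
    simp only [← mk_mul, ← map_add, add_mul]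
  zero_mul a := by
    obtain ⟨x, rfl⟩ := mk_surjective k E a
    rw [← map_zero (mk k E), ← mk_mul, zero_mul]
  mul_zero a := by
    obtain ⟨x, rfl⟩ := mk_surjective k E a
    rw [← map_zero (mk k E), ← mk_mul, mul_zero]
  mul_assoc a b c := by
    obtain ⟨x, rfl⟩ := mk_surjective k E a
    obtain ⟨y, rfl⟩ := mk_surjective k E b
    obtain ⟨z, rfl⟩ := mk_surjective k E c
    simp only [← mk_mul, mul_assoc]

instance : IsScalarTower k (LPA k E) (LPA k E) where
  smul_assoc c a b := by
    obtain ⟨x, rfl⟩ := mk_surjective k E a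
    obtain ⟨y, rfl⟩ := mk_surjective k E b
    simp only [smul_eq_mul, ← mk_mul, ← map_smul, smul_mul_assoc]

instance : SMulCommClass k (LPA k E) (LPA k E) where
  smul_comm c a b := by
    obtain ⟨x, rfl⟩ := mk_surjective k E a
    obtain ⟨y, rfl⟩ := mk_surjective k E b
    simp only [smul_eq_mul, ← mk_mul, ← map_smul, mul_smul_comm]

/-- The generator `p_v`. -/
def p (v : V) : LPA k E := mk k E (FreeGenAlg.gen k (.p v))

/-- The generator `s_e`. -/
def s (e : Ed) : LPA k E := mk k E (FreeGenAlg.gen k (.s e))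

/-- The generator `s_e^*`. -/
def sStar (e : Ed) : LPA k E := mk k E (FreeGenAlg.gen k (.sStar e))

/-- `I_H`, the two-sided ideal of `L_k(E)` generated by the `p_v`, `v ∈ H`, as an algebra. -/
def vertexIdeal (H : Set V) : NonUnitalSubalgebra k (LPA k E) where
  toSubmodule := idealSpan k (p k E '' H)
  mul_mem' {a b} _ hb := (isTwoSidedIdeal_idealSpan (p k E '' H) a b hb).1

theorem induction {P : LPA k E → Prop} (hp : ∀ v, P (p k E v)) (hs : ∀ e, P (s k E e))
    (hsStar : ∀ e, P (sStar k E e)) (hzero : P 0) (hadd : ∀ a b, P a → P b → P (a + b))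
    (hmul : ∀ a b, P a → P b → P (a * b)) (hsmul : ∀ (c : k) a, P a → P (c • a))
    (a : LPA k E) : P a := by
  obtain ⟨x, rfl⟩ := mk_surjective k E a
  induction x using MonoidAlgebra.induction_linear with
  | zero => simpa using hzero
  | add x y hx hy => simpa using hadd _ _ hx hy
  | single w c =>
    have h1 : (MonoidAlgebra.single w c : FreeGenAlg k V Ed) = c • MonoidAlgebra.single w 1 := by
      simp
    rw [h1, map_smul]
    apply hsmul
    clear h1
    have hgen (g : LPAGen V Ed) : P (mk k E (MonoidAlgebra.single (FreeSemigroup.of g) 1)) := by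
      cases g with
      | p v => exact hp v
      | s e => exact hs e
      | sStar e => exact hsStar e
    induction w using FreeSemigroup.recOnMul with
    | ih1 g => exact hgen g
    | ih2 g w _ hw =>
      have h2 : (MonoidAlgebra.single (FreeSemigroup.of g * w) 1 : FreeGenAlg k V Ed)
          = MonoidAlgebra.single (FreeSemigroup.of g) 1 * MonoidAlgebra.single w 1 := by
        simp [MonoidAlgebra.single_mul_single]
      rw [h2, mk_mul]
      exact hmul _ _ (hgen g) hw

theorem mk_relator {x : FreeGenAlg k V Ed} (h : LPARelator k E x) : mk k E x = 0 :=
  (mk_eq_zero k E).2 (subset_idealSpan _ h)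

theorem p_mul_p (v : V) : p k E v * p k E v = p k E v :=
  sub_eq_zero.1 <| by simpa [mk_mul] using! mk_relator k E (.idem v)

theorem p_mul_p_of_ne {v w : V} (h : v ≠ w) : p k E v * p k E w = 0 :=
  mk_relator k E (.orth v w h)

theorem p_mul_s (e : Ed) : p k E (E.s e) * s k E e = s k E e :=
  sub_eq_zero.1 <| by simpa [mk_mul] using! mk_relator k E (.source_s e)

theorem s_mul_p (e : Ed) : s k E e * p k E (E.r e) = s k E e :=
  sub_eq_zero.1 <| by simpa [mk_mul] using! mk_relator k E (.s_range e)

theorem sStar_mul_s (e : Ed) : sStar k E e * s k E e = p k E (E.r e) :=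
  sub_eq_zero.1 <| by simpa [mk_mul] using! mk_relator k E (.sStar_s e)

theorem sStar_mul_s_of_ne {e f : Ed} (h : e ≠ f) : sStar k E e * s k E f = 0 :=
  mk_relator k E (.sStar_s_ne e f h)

theorem p_eq_sum (v : V) (F : Finset Ed) (hne : F.Nonempty) (hF : ∀ e, e ∈ F ↔ E.s e = v) :
    p k E v = ∑ e ∈ F, s k E e * sStar k E e :=
  sub_eq_zero.1 <| by simpa [mk_mul] using! mk_relator k E (.sum v F hne hF)

/-- The universal property of `L_k(E)`: elements of a `k`-algebra that satisfy the Leavitt path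
algebra relations are the images of the generators under a unique homomorphism. -/
theorem existsUnique_lift {B : Type*} [NonUnitalRing B] [Module k B] [IsScalarTower k B B]
    [SMulCommClass k B B] (P : V → B) (S T : Ed → B)
    (h1 : ∀ v, P v * P v = P v) (h2 : ∀ v w, v ≠ w → P v * P w = 0)
    (h3 : ∀ e, P (E.s e) * S e = S e) (h4 : ∀ e, S e * P (E.r e) = S e)
    (h5 : ∀ e, P (E.r e) * T e = T e) (h6 : ∀ e, T e * P (E.s e) = T e)
    (h7 : ∀ e, T e * S e = P (E.r e)) (h8 : ∀ e f, e ≠ f → T e * S f = 0)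
    (h9 : ∀ v (F : Finset Ed), F.Nonempty → (∀ e, e ∈ F ↔ E.s e = v) →
      P v = ∑ e ∈ F, S e * T e) :
    ∃! φ : LPA k E →ₙₐ[k] B, (∀ v, φ (p k E v) = P v) ∧ (∀ e, φ (s k E e) = S e) ∧
      ∀ e, φ (sStar k E e) = T e := by
  let g : LPAGen V Ed → B := fun x => match x with
    | .p v => P v
    | .s e => S e
    | .sStar e => T e
  let ψ : FreeGenAlg k V Ed →ₙₐ[k] B := MonoidAlgebra.liftMagma k (FreeSemigroup.lift g)
  have hψ (x : LPAGen V Ed) : ψ (FreeGenAlg.gen k x) = g x := by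
    simp [ψ, FreeGenAlg.gen, MonoidAlgebra.liftMagma]
  let K : Submodule k (FreeGenAlg k V Ed) := LinearMap.ker (ψ : FreeGenAlg k V Ed →ₗ[k] B)
  have hKmem (x : FreeGenAlg k V Ed) : x ∈ K ↔ ψ x = 0 := LinearMap.mem_ker
  have hK : lpaRelIdeal k E ≤ K := by
    refine idealSpan_le (fun x hx => ?_) (fun a x hx => ?_)
    · change x ∈ K
      rw [hKmem]
      cases hx with
      | idem v => simp [hψ, g, h1]
      | orth v w h => simp [hψ, g, h2 v w h]
      | source_s e => simp [hψ, g, h3]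
      | s_range e => simp [hψ, g, h4]
      | range_sStar e => simp [hψ, g, h5]
      | sStar_source e => simp [hψ, g, h6]
      | sStar_s e => simp [hψ, g, h7]
      | sStar_s_ne e f h => simp [hψ, g, h8 e f h]
      | sum v F hne hF => simp [hψ, g, h9 v F hne hF]
    · rw [hKmem] at hx
      simp [hKmem, hx]
  let χ : LPA k E →ₗ[k] B := (lpaRelIdeal k E).liftQ (ψ : FreeGenAlg k V Ed →ₗ[k] B) hK
  have hχ (x : FreeGenAlg k V Ed) : χ (mk k E x) = ψ x := rfl
  let φ : LPA k E →ₙₐ[k] B :=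
    { toFun := χ
      map_smul' := fun c x => χ.map_smul c x
      map_zero' := χ.map_zero
      map_add' := χ.map_add
      map_mul' := fun a b => by
        obtain ⟨x, rfl⟩ := mk_surjective k E a
        obtain ⟨y, rfl⟩ := mk_surjective k E b
        rw [← mk_mul, hχ, hχ, hχ, map_mul] }
  have hφ (x : FreeGenAlg k V Ed) : φ (mk k E x) = ψ x := rfl
  refine ⟨φ, ⟨fun v => (hφ _).trans (hψ _), fun e => (hφ _).trans (hψ _),
    fun e => (hφ _).trans (hψ _)⟩, fun φ' h' => ?_⟩
  obtain ⟨hp, hs, ht⟩ := h'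
  ext a
  induction a using LPA.induction with
  | hp v => exact (hp v).trans ((hφ _).trans (hψ (.p v))).symm
  | hs e => exact (hs e).trans ((hφ _).trans (hψ (.s e))).symm
  | hsStar e => exact (ht e).trans ((hφ _).trans (hψ (.sStar e))).symm
  | hzero => simp
  | hadd a b ha hb => rw [map_add, map_add, ha, hb]
  | hmul a b ha hb => rw [map_mul, map_mul, ha, hb]
  | hsmul c a ha => rw [map_smul, map_smul, ha]

/-! #### The involution -/

section Star

variable [StarRing k]

open FreeGenAlg in
theorem star_relator {x : FreeGenAlg k V Ed} (h : LPARelator k E x) : LPARelator k E (star x) := by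
  cases h with
  | idem v => simpa [star_gen, LPAGen.swap] using LPARelator.idem (k := k) (E := E) v
  | orth v w h => simpa [star_gen, LPAGen.swap] using LPARelator.orth (k := k) (E := E) w v h.symm
  | source_s e => simpa [star_gen, LPAGen.swap] using LPARelator.sStar_source (k := k) (E := E) e
  | s_range e => simpa [star_gen, LPAGen.swap] using LPARelator.range_sStar (k := k) (E := E) e
  | range_sStar e => simpa [star_gen, LPAGen.swap] using LPARelator.s_range (k := k) (E := E) e
  | sStar_source e => simpa [star_gen, LPAGen.swap] using LPARelator.source_s (k := k) (E := E) e
  | sStar_s e => simpa [star_gen, LPAGen.swap] using LPARelator.sStar_s (k := k) (E := E) e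
  | sStar_s_ne e f h =>
    simpa [star_gen, LPAGen.swap] using LPARelator.sStar_s_ne (k := k) (E := E) f e h.symm
  | sum v F hne hF =>
    simpa [star_gen, LPAGen.swap] using LPARelator.sum (k := k) (E := E) v F hne hF

theorem star_mem_relIdeal {x : FreeGenAlg k V Ed} (h : x ∈ lpaRelIdeal k E) :
    star x ∈ lpaRelIdeal k E :=
  star_mem_idealSpan (fun _ hy => star_relator k E hy) h

instance : Star (LPA k E) where
  star a := Quotient.liftOn' a (fun x => mk k E (star x)) (by
    intro x y h
    rw [Submodule.quotientRel_def] at h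
    rw [mk_eq_mk, ← star_sub]
    exact star_mem_relIdeal k E h)

theorem star_mk (x : FreeGenAlg k V Ed) : star (mk k E x) = mk k E (star x) := rfl

/-- The involution of `L_k(E)`: the antimultiplicative involution, semilinear with respect to the
given involution of `k`, that fixes each `p_v` and exchanges `s_e` and `s_e^*`. -/
instance : StarRing (LPA k E) where
  star_involutive a := by
    obtain ⟨x, rfl⟩ := mk_surjective k E a
    simp only [star_mk, star_star]
  star_mul a b := by
    obtain ⟨x, rfl⟩ := mk_surjective k E a
    obtain ⟨y, rfl⟩ := mk_surjective k E b
    simp only [star_mk, ← mk_mul, star_mul]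
  star_add a b := by
    obtain ⟨x, rfl⟩ := mk_surjective k E a
    obtain ⟨y, rfl⟩ := mk_surjective k E b
    simp only [star_mk, ← map_add, star_add]

instance : StarModule k (LPA k E) where
  star_smul c a := by
    obtain ⟨x, rfl⟩ := mk_surjective k E a
    simp only [star_mk, ← map_smul, star_smul]

theorem star_p (v : V) : star (p k E v) = p k E v := by
  simp [p, star_mk, FreeGenAlg.star_gen, LPAGen.swap]

theorem star_s (e : Ed) : star (s k E e) = sStar k E e := by
  simp [s, sStar, star_mk, FreeGenAlg.star_gen, LPAGen.swap]

theorem star_sStar (e : Ed) : star (sStar k E e) = s k E e := by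
  simp [s, sStar, star_mk, FreeGenAlg.star_gen, LPAGen.swap]

instance (H : Set V) : Star (vertexIdeal k E H) where
  star x := ⟨star x.1, star_mem_idealSpan (by rintro _ ⟨v, hv, rfl⟩; exact ⟨v, hv, by simp [star_p]⟩)
    x.2⟩

end Star

end LPA

/-! ### Finitely supported matrices -/

/-- `M_Λ(k)`: the `Λ × Λ` matrices over `k` with finitely many nonzero entries. -/
def FinMatrix (Λ k : Type*) [Field k] : Type _ := Λ × Λ →₀ k

namespace FinMatrix

theorem exists_ne_zero_of_finsum {ι M : Type*} [AddCommMonoid M] {f : ι → M}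
    (h : ∑ᶠ i, f i ≠ 0) : ∃ i, f i ≠ 0 := by
  by_contra! h'
  exact h (by simp [h'])

variable {Λ k : Type*} [Field k]

instance : AddCommGroup (FinMatrix Λ k) := inferInstanceAs (AddCommGroup (Λ × Λ →₀ k))

instance : Module k (FinMatrix Λ k) := inferInstanceAs (Module k (Λ × Λ →₀ k))

/-- The entry of `A` in row `i` and column `j`. -/
def entry (A : FinMatrix Λ k) (i j : Λ) : k := (show Λ × Λ →₀ k from A) (i, j)

@[ext] theorem ext {A B : FinMatrix Λ k} (h : ∀ i j, A.entry i j = B.entry i j) : A = B :=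
  Finsupp.ext fun ⟨i, j⟩ => h i j

@[simp] theorem entry_zero (i j : Λ) : (0 : FinMatrix Λ k).entry i j = 0 := rfl

@[simp] theorem entry_add (A B : FinMatrix Λ k) (i j : Λ) :
    (A + B).entry i j = A.entry i j + B.entry i j := rfl

@[simp] theorem entry_smul (c : k) (A : FinMatrix Λ k) (i j : Λ) :
    (c • A).entry i j = c * A.entry i j := rfl

theorem finite_row (A : FinMatrix Λ k) (i : Λ) : {l | A.entry i l ≠ 0}.Finite :=
  Set.Finite.subset ((show Λ × Λ →₀ k from A).support.finite_toSet.image Prod.snd) fun l hl =>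
    ⟨(i, l), Finsupp.mem_support_iff.2 hl, rfl⟩

/-- Matrix multiplication: `(A * B)ᵢⱼ = ∑ₗ Aᵢₗ Bₗⱼ`, a sum with finitely many nonzero terms. -/
instance : Mul (FinMatrix Λ k) where
  mul A B := Finsupp.ofSupportFinite (fun x : Λ × Λ => ∑ᶠ l, A.entry x.1 l * B.entry l x.2) (by
    refine Set.Finite.subset
      (((show Λ × Λ →₀ k from A).support.finite_toSet.image Prod.fst).prod
        ((show Λ × Λ →₀ k from B).support.finite_toSet.image Prod.snd)) ?_
    rintro ⟨i, j⟩ hij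
    obtain ⟨l, hl⟩ := exists_ne_zero_of_finsum hij
    exact ⟨⟨(i, l), Finsupp.mem_support_iff.2 (left_ne_zero_of_mul hl), rfl⟩,
      ⟨(l, j), Finsupp.mem_support_iff.2 (right_ne_zero_of_mul hl), rfl⟩⟩)

theorem entry_mul (A B : FinMatrix Λ k) (i j : Λ) :
    (A * B).entry i j = ∑ᶠ l, A.entry i l * B.entry l j := rfl

theorem finite_support_mul (A B : FinMatrix Λ k) (i j : Λ) :
    (Function.support fun l => A.entry i l * B.entry l j).Finite :=
  (finite_row A i).subset fun _ hl => left_ne_zero_of_mul hl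

theorem entry_mul_eq_sum (A B : FinMatrix Λ k) (i j : Λ) {s : Finset Λ}
    (hs : ∀ l, A.entry i l ≠ 0 → l ∈ s) :
    (A * B).entry i j = ∑ l ∈ s, A.entry i l * B.entry l j := by
  rw [entry_mul]
  exact finsum_eq_sum_of_support_subset _ fun l hl => hs l (left_ne_zero_of_mul hl)

instance : NonUnitalRing (FinMatrix Λ k) where
  left_distrib A B C := by
    ext i j
    simp only [entry_mul, entry_add, mul_add]
    exact finsum_add_distrib (finite_support_mul A B i j) (finite_support_mul A C i j)
  right_distrib A B C := by
    ext i j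
    simp only [entry_mul, entry_add, add_mul]
    exact finsum_add_distrib (finite_support_mul A C i j) (finite_support_mul B C i j)
  zero_mul A := by ext i j; simp [entry_mul]
  mul_zero A := by ext i j; simp [entry_mul]
  mul_assoc A B C := by
    classical
    ext i j
    let s : Finset Λ := (show Λ × Λ →₀ k from A).support.image Prod.snd
    let t : Finset Λ := (show Λ × Λ →₀ k from B).support.image Prod.snd
    have hs (i l : Λ) (h : A.entry i l ≠ 0) : l ∈ s :=
      Finset.mem_image.2 ⟨(i, l), Finsupp.mem_support_iff.2 h, rfl⟩
    have ht (i l : Λ) (h : B.entry i l ≠ 0) : l ∈ t :=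
      Finset.mem_image.2 ⟨(i, l), Finsupp.mem_support_iff.2 h, rfl⟩
    have hst (l : Λ) (h : (A * B).entry i l ≠ 0) : l ∈ t := by
      rw [entry_mul] at h
      obtain ⟨m, hm⟩ := exists_ne_zero_of_finsum h
      exact ht m l (right_ne_zero_of_mul hm)
    rw [entry_mul_eq_sum _ _ _ _ hst, entry_mul_eq_sum _ _ _ _ (hs i)]
    simp only [entry_mul_eq_sum _ _ _ _ (hs i), entry_mul_eq_sum _ _ _ _ (ht _), Finset.sum_mul,
      Finset.mul_sum, mul_assoc]
    exact Finset.sum_comm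

instance : IsScalarTower k (FinMatrix Λ k) (FinMatrix Λ k) where
  smul_assoc c A B := by
    ext i j
    simp only [smul_eq_mul, entry_mul, entry_smul, mul_assoc]
    exact (mul_finsum' _ c (finite_support_mul A B i j)).symm

instance : SMulCommClass k (FinMatrix Λ k) (FinMatrix Λ k) where
  smul_comm c A B := by
    ext i j
    simp only [smul_eq_mul, entry_mul, entry_smul, mul_left_comm _ c]
    exact mul_finsum' _ c (finite_support_mul A B i j)

/-- The conjugate transpose, for a given involution of `k`. -/
instance [StarRing k] : Star (FinMatrix Λ k) where
  star A := Finsupp.ofSupportFinite (fun x : Λ × Λ => star (A.entry x.2 x.1))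
    (Set.Finite.subset ((show Λ × Λ →₀ k from A).support.finite_toSet.image Prod.swap) (by
      rintro ⟨i, j⟩ hij
      exact ⟨(j, i), Finsupp.mem_support_iff.2 (star_ne_zero.1 hij), rfl⟩))

theorem entry_star [StarRing k] (A : FinMatrix Λ k) (i j : Λ) :
    (star A).entry i j = star (A.entry j i) := rfl

end FinMatrix

/-! ### Compact operators -/

section Compact

variable (H : Type*) [NormedAddCommGroup H] [InnerProductSpace ℂ H] [CompleteSpace H]

/-- The adjoint of a compact operator on a Hilbert space is compact. -/
theorem IsCompactOperator.star_hilbert {H : Type*} [NormedAddCommGroup H]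
    [InnerProductSpace ℂ H] [CompleteSpace H] {T : H →L[ℂ] H} (hT : IsCompactOperator T) :
    IsCompactOperator (star T : H →L[ℂ] H) := by
  have hS : IsCompactOperator (T * star T : H →L[ℂ] H) := hT.comp_clm (star T)
  have key (z : H) : ‖(star T) z‖ ^ 2 ≤ ‖(T * star T) z‖ * ‖z‖ := by
    rw [← inner_self_eq_norm_sq (𝕜 := ℂ), ContinuousLinearMap.star_eq_adjoint,
      ContinuousLinearMap.adjoint_inner_right]
    exact (Complex.re_le_norm _).trans (norm_inner_le_norm _ _)
  replace hS := (isCompactOperator_iff_isCompact_closure_image_closedBall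
    (T * star T : H →L[ℂ] H).toLinearMap one_pos).1 hS
  refine (isCompactOperator_iff_isCompact_closure_image_closedBall
    (star T : H →L[ℂ] H).toLinearMap one_pos).2 ?_
  refine TotallyBounded.isCompact_of_isClosed ?_ isClosed_closure
  refine TotallyBounded.closure ?_
  have hS' := hS.totallyBounded.subset subset_closure
  refine Metric.totallyBounded_of_finite_discretization fun ε hε => ?_
  obtain ⟨t, htf, ht⟩ := Metric.totallyBounded_iff.1 hS' (ε ^ 2 / 8) (by positivity)
  have := htf.fintype
  have hx (x : (star T : H →L[ℂ] H).toLinearMap '' Metric.closedBall 0 1) :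
      ∃ c : t, ∃ z : H, ‖z‖ ≤ 1 ∧ (star T) z = x ∧ dist ((T * star T) z) c < ε ^ 2 / 8 := by
    obtain ⟨_, z, hz, rfl⟩ := x
    obtain ⟨c, hc, hd⟩ := Set.mem_iUnion₂.1 (ht ⟨z, hz, rfl⟩)
    exact ⟨⟨c, hc⟩, z, by simpa using hz, rfl, hd⟩
  choose F z hz1 hz2 hz3 using hx
  refine ⟨t, inferInstance, F, fun x y hxy => ?_⟩
  have h1 := hz3 x
  have h2 := hz3 y
  rw [hxy] at h1
  have h3 : ‖(T * star T) (z x - z y)‖ < ε ^ 2 / 4 := by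
    rw [map_sub, ← dist_eq_norm]
    have := dist_triangle_right ((T * star T) (z x)) ((T * star T) (z y)) (F y : H)
    linarith
  have h4 : ‖z x - z y‖ ≤ 2 := (norm_sub_le _ _).trans (by linarith [hz1 x, hz1 y])
  have h5 := key (z x - z y)
  rw [map_sub, hz2, hz2] at h5
  rw [dist_eq_norm]
  have h6 : ‖(x : H) - y‖ ^ 2 < ε ^ 2 := by
    nlinarith [norm_nonneg ((T * star T) (z x - z y)), norm_nonneg (z x - z y)]
  exact lt_of_pow_lt_pow_left₀ 2 hε.le h6

/-- `K(H)`: the `C^*`-algebra of compact operators on the Hilbert space `H`. -/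
def compactOps : NonUnitalStarSubalgebra ℂ (H →L[ℂ] H) where
  carrier := {T | IsCompactOperator T}
  add_mem' hS hT := hS.add hT
  zero_mem' := isCompactOperator_zero
  mul_mem' {_ T} hS _ := hS.comp_clm T
  smul_mem' c _ hT := hT.smul c
  star_mem' hT := hT.star_hilbert

end Compact

/-! ### Graph `C^*`-algebras -/

section CStarSeminorm

variable {A : Type*} [NonUnitalRing A] [StarRing A] [Module ℂ A]

/-- A `C^*`-seminorm on a `*`-algebra. -/
structure IsCStarSeminorm (N : Seminorm ℂ A) : Prop where
  mul_le : ∀ x y, N (x * y) ≤ N x * N y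
  star_mul_self : ∀ x, N (star x * x) = N x ^ 2

theorem IsCStarSeminorm.star_eq {N : Seminorm ℂ A} (hN : IsCStarSeminorm N) (x : A) :
    N (star x) = N x := by
  have key (y : A) : N y ≤ N (star y) := by
    rcases (apply_nonneg N y).eq_or_lt with h | h
    · rw [← h]; exact apply_nonneg N _
    · have h1 := hN.mul_le (star y) y
      rw [hN.star_mul_self, sq] at h1
      exact le_of_mul_le_mul_right h1 h
  exact le_antisymm (by simpa using key (star x)) (key x)

variable (A) in
/-- The universal `C^*`-seminorm: the supremum of all `C^*`-seminorms (when these are pointwise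
bounded). -/
def univCStarSeminorm : Seminorm ℂ A := sSup {N | IsCStarSeminorm N}

theorem le_univCStarSeminorm (hb : BddAbove {N : Seminorm ℂ A | IsCStarSeminorm N})
    {N : Seminorm ℂ A} (hN : IsCStarSeminorm N) : N ≤ univCStarSeminorm A := le_csSup hb hN

theorem univCStarSeminorm_apply_le (hb : BddAbove {N : Seminorm ℂ A | IsCStarSeminorm N})
    {x : A} {C : ℝ} (hC : 0 ≤ C) (h : ∀ N : Seminorm ℂ A, IsCStarSeminorm N → N x ≤ C) :
    univCStarSeminorm A x ≤ C := by
  rw [univCStarSeminorm, Seminorm.sSup_apply hb]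
  exact Real.iSup_le (fun N => h N.1 N.2) hC

theorem isCStarSeminorm_univ (hb : BddAbove {N : Seminorm ℂ A | IsCStarSeminorm N}) :
    IsCStarSeminorm (univCStarSeminorm A) where
  mul_le x y := univCStarSeminorm_apply_le hb (by positivity) fun N hN =>
    (hN.mul_le x y).trans (mul_le_mul (le_univCStarSeminorm hb hN x) (le_univCStarSeminorm hb hN y)
      (apply_nonneg _ _) (apply_nonneg _ _))
  star_mul_self x := by
    refine le_antisymm (univCStarSeminorm_apply_le hb (by positivity) fun N hN => ?_) ?_
    · rw [hN.star_mul_self]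
      exact pow_le_pow_left₀ (apply_nonneg _ _) (le_univCStarSeminorm hb hN x) 2
    · refine (Real.le_sqrt (apply_nonneg _ _) (apply_nonneg _ _)).1 ?_
      refine univCStarSeminorm_apply_le hb (Real.sqrt_nonneg _) fun N hN => ?_
      refine Real.le_sqrt_of_sq_le ?_
      rw [← hN.star_mul_self]
      exact le_univCStarSeminorm hb hN _

end CStarSeminorm

section

variable {V Ed : Type*} (E : DirGraph V Ed)

/-- The `C^*`-seminorms on `L_ℂ(E)` are pointwise bounded, because the generators are projections
and partial isometries. -/
theorem bddAbove_cStarSeminorm : BddAbove {N : Seminorm ℂ (LPA ℂ E) | IsCStarSeminorm N} := by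
  have key (x : LPA ℂ E) :
      ∃ C : ℝ, ∀ N : Seminorm ℂ (LPA ℂ E), IsCStarSeminorm N → N x ≤ C := by
    have hp (v : V) (N : Seminorm ℂ (LPA ℂ E)) (hN : IsCStarSeminorm N) :
        N (LPA.p ℂ E v) ≤ 1 := by
      have := hN.star_mul_self (LPA.p ℂ E v)
      rw [LPA.star_p, LPA.p_mul_p] at this
      nlinarith [apply_nonneg N (LPA.p ℂ E v)]
    have hs (e : Ed) (N : Seminorm ℂ (LPA ℂ E)) (hN : IsCStarSeminorm N) :
        N (LPA.s ℂ E e) ≤ 1 := by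
      have := hN.star_mul_self (LPA.s ℂ E e)
      rw [LPA.star_s, LPA.sStar_mul_s] at this
      have := hp (E.r e) N hN
      nlinarith [apply_nonneg N (LPA.s ℂ E e)]
    induction x using LPA.induction with
    | hp v => exact ⟨1, hp v⟩
    | hs e => exact ⟨1, hs e⟩
    | hsStar e =>
      refine ⟨1, fun N hN => ?_⟩
      rw [← LPA.star_s, hN.star_eq]
      exact hs e N hN
    | hzero => exact ⟨0, fun N _ => by simp⟩
    | hadd a b ha hb =>
      obtain ⟨C, hC⟩ := ha
      obtain ⟨D, hD⟩ := hb
      exact ⟨C + D, fun N hN => (map_add_le_add N a b).trans (add_le_add (hC N hN) (hD N hN))⟩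
    | hmul a b ha hb =>
      obtain ⟨C, hC⟩ := ha
      obtain ⟨D, hD⟩ := hb
      exact ⟨C * D, fun N hN => (hN.mul_le a b).trans (mul_le_mul (hC N hN) (hD N hN)
        (apply_nonneg _ _) ((apply_nonneg _ _).trans (hC N hN)))⟩
    | hsmul c a ha =>
      obtain ⟨C, hC⟩ := ha
      exact ⟨‖c‖ * C, fun N hN => by
        rw [map_smul_eq_mul]
        exact mul_le_mul_of_nonneg_left (hC N hN) (norm_nonneg c)⟩
  choose C hC using key
  rw [Seminorm.bddAbove_iff]
  refine ⟨C, ?_⟩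
  rintro _ ⟨N, hN, rfl⟩
  exact fun x => hC x N hN

/-- The `*`-algebra `L_ℂ(E)` (with the conjugate linear involution), equipped with its universal
`C^*`-seminorm. -/
def PreGraphCStar : Type _ := LPA ℂ E

namespace PreGraphCStar

instance : NonUnitalRing (PreGraphCStar E) := inferInstanceAs (NonUnitalRing (LPA ℂ E))
instance : StarRing (PreGraphCStar E) := inferInstanceAs (StarRing (LPA ℂ E))
instance : Module ℂ (PreGraphCStar E) := inferInstanceAs (Module ℂ (LPA ℂ E))
instance : IsScalarTower ℂ (PreGraphCStar E) (PreGraphCStar E) :=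
  inferInstanceAs (IsScalarTower ℂ (LPA ℂ E) (LPA ℂ E))
instance : SMulCommClass ℂ (PreGraphCStar E) (PreGraphCStar E) :=
  inferInstanceAs (SMulCommClass ℂ (LPA ℂ E) (LPA ℂ E))
instance : StarModule ℂ (PreGraphCStar E) := inferInstanceAs (StarModule ℂ (LPA ℂ E))

instance : Norm (PreGraphCStar E) where
  norm x := univCStarSeminorm (LPA ℂ E) x

instance : PseudoMetricSpace (PreGraphCStar E) :=
  (univCStarSeminorm (LPA ℂ E)).toAddGroupSeminorm.toSeminormedAddCommGroup.toPseudoMetricSpace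

instance : NonUnitalSeminormedRing (PreGraphCStar E) where
  __ := (inferInstance : NonUnitalRing (PreGraphCStar E))
  dist_eq := (univCStarSeminorm
    (LPA ℂ E)).toAddGroupSeminorm.toSeminormedAddCommGroup.dist_eq
  norm_mul_le x y := (isCStarSeminorm_univ (bddAbove_cStarSeminorm E)).mul_le x y

instance : NormedSpace ℂ (PreGraphCStar E) where
  __ := (inferInstance : Module ℂ (PreGraphCStar E))
  norm_smul_le c x := (map_smul_eq_mul (univCStarSeminorm (LPA ℂ E)) c x).le

theorem norm_def (x : PreGraphCStar E) : ‖x‖ = univCStarSeminorm (LPA ℂ E) x := rfl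

instance : NormedStarGroup (PreGraphCStar E) where
  norm_star_le x := ((isCStarSeminorm_univ (bddAbove_cStarSeminorm E)).star_eq x).le

theorem norm_star_mul_self (x : PreGraphCStar E) : ‖star x * x‖ = ‖x‖ * ‖x‖ :=
  ((isCStarSeminorm_univ (bddAbove_cStarSeminorm E)).star_mul_self x).trans (sq _)

end PreGraphCStar

/-- The graph `C^*`-algebra `C^*(E)`: the completion of `L_ℂ(E)` with respect to its universal
`C^*`-seminorm. -/
def GraphCStar : Type _ := Completion (PreGraphCStar E)

namespace GraphCStar

open UniformSpace.Completion

instance : NormedAddCommGroup (GraphCStar E) :=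
  inferInstanceAs (NormedAddCommGroup (Completion (PreGraphCStar E)))

instance : CompleteSpace (GraphCStar E) :=
  inferInstanceAs (CompleteSpace (Completion (PreGraphCStar E)))

instance : NormedSpace ℂ (GraphCStar E) :=
  inferInstanceAs (NormedSpace ℂ (Completion (PreGraphCStar E)))

/-- The canonical map from `L_ℂ(E)`. -/
def of : PreGraphCStar E →ₗ[ℂ] GraphCStar E :=
  (UniformSpace.Completion.toComplL (𝕜 := ℂ) (E := PreGraphCStar E)).toLinearMap

theorem isDenseInducing_of : IsDenseInducing (of E) :=
  UniformSpace.Completion.isDenseInducing_coe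

theorem norm_of (x : PreGraphCStar E) : ‖of E x‖ = ‖x‖ := UniformSpace.Completion.norm_coe x

instance : Mul (GraphCStar E) where
  mul a b := ((isDenseInducing_of E).prodMap (isDenseInducing_of E)).extend
    (fun x : PreGraphCStar E × PreGraphCStar E => of E (x.1 * x.2)) (a, b)

theorem of_mul (x y : PreGraphCStar E) : of E (x * y) = of E x * of E y :=
  (((isDenseInducing_of E).prodMap (isDenseInducing_of E)).extend_eq
    ((isDenseInducing_of E).continuous.comp continuous_mul) (x, y)).symm

instance : ContinuousMul (GraphCStar E) where
  continuous_mul := by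
    let m := (AddMonoidHom.mul : PreGraphCStar E →+ PreGraphCStar E →+ PreGraphCStar E).compr₂
      (of E).toAddMonoidHom
    have hm : Continuous fun x : PreGraphCStar E × PreGraphCStar E => m x.1 x.2 :=
      (isDenseInducing_of E).continuous.comp continuous_mul
    have di : IsDenseInducing ((of E).toAddMonoidHom : PreGraphCStar E → GraphCStar E) :=
      isDenseInducing_of E
    exact di.extend_Z_bilin di hm

theorem induction {P : GraphCStar E → Prop} (hP : IsClosed {a | P a})
    (h : ∀ x, P (of E x)) (a : GraphCStar E) : P a :=
  (isDenseInducing_of E).dense.induction_on a hP h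

theorem norm_mul_le_aux (a b : GraphCStar E) : ‖a * b‖ ≤ ‖a‖ * ‖b‖ := by
  induction a using GraphCStar.induction with
  | hP =>
    exact isClosed_le (f := fun a : GraphCStar E => ‖a * b‖) (g := fun a => ‖a‖ * ‖b‖)
      (continuous_id.mul continuous_const).norm (continuous_norm.mul continuous_const)
  | h x =>
  induction b using GraphCStar.induction with
  | hP =>
    exact isClosed_le (f := fun b : GraphCStar E => ‖of E x * b‖)
      (g := fun b => ‖of E x‖ * ‖b‖)
      (continuous_const.mul continuous_id).norm (continuous_const.mul continuous_norm)
  | h y =>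
    rw [← of_mul, norm_of, norm_of, norm_of]
    exact norm_mul_le x y

theorem isClosed_setOf_eq {f g : GraphCStar E → GraphCStar E} (hf : Continuous f)
    (hg : Continuous g) : IsClosed {a | f a = g a} := isClosed_eq hf hg

theorem mul_assoc_aux (a b c : GraphCStar E) : a * b * c = a * (b * c) := by
  induction a using GraphCStar.induction with
  | hP =>
    exact isClosed_setOf_eq E (f := fun a => a * b * c) (g := fun a => a * (b * c))
      ((continuous_id.mul continuous_const).mul continuous_const)
      (continuous_id.mul continuous_const)
  | h x =>
  induction b using GraphCStar.induction with
  | hP =>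
    exact isClosed_setOf_eq E (f := fun b => of E x * b * c) (g := fun b => of E x * (b * c))
      ((continuous_const.mul continuous_id).mul continuous_const)
      (continuous_const.mul (continuous_id.mul continuous_const))
  | h y =>
  induction c using GraphCStar.induction with
  | hP =>
    exact isClosed_setOf_eq E (f := fun c => of E x * of E y * c)
      (g := fun c => of E x * (of E y * c))
      (continuous_const.mul continuous_id)
      (continuous_const.mul (continuous_const.mul continuous_id))
  | h z => rw [← of_mul, ← of_mul, ← of_mul, ← of_mul, mul_assoc]

theorem mul_add_aux (a b c : GraphCStar E) : a * (b + c) = a * b + a * c := by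
  induction a using GraphCStar.induction with
  | hP =>
    exact isClosed_setOf_eq E (f := fun a => a * (b + c)) (g := fun a => a * b + a * c)
      (continuous_id.mul continuous_const)
      ((continuous_id.mul continuous_const).add (continuous_id.mul continuous_const))
  | h x =>
  induction b using GraphCStar.induction with
  | hP =>
    exact isClosed_setOf_eq E (f := fun b => of E x * (b + c)) (g := fun b => of E x * b + of E x * c)
      (continuous_const.mul (continuous_id.add continuous_const))
      ((continuous_const.mul continuous_id).add continuous_const)
  | h y =>
  induction c using GraphCStar.induction with
  | hP =>
    exact isClosed_setOf_eq E (f := fun c => of E x * (of E y + c))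
      (g := fun c => of E x * of E y + of E x * c)
      (continuous_const.mul (continuous_const.add continuous_id))
      (continuous_const.add (continuous_const.mul continuous_id))
  | h z => rw [← map_add, ← of_mul, ← of_mul, ← of_mul, ← map_add, mul_add]

theorem add_mul_aux (a b c : GraphCStar E) : (a + b) * c = a * c + b * c := by
  induction a using GraphCStar.induction with
  | hP =>
    exact isClosed_setOf_eq E (f := fun a => (a + b) * c) (g := fun a => a * c + b * c)
      ((continuous_id.add continuous_const).mul continuous_const)
      ((continuous_id.mul continuous_const).add continuous_const)
  | h x =>
  induction b using GraphCStar.induction with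
  | hP =>
    exact isClosed_setOf_eq E (f := fun b => (of E x + b) * c) (g := fun b => of E x * c + b * c)
      ((continuous_const.add continuous_id).mul continuous_const)
      (continuous_const.add (continuous_id.mul continuous_const))
  | h y =>
  induction c using GraphCStar.induction with
  | hP =>
    exact isClosed_setOf_eq E (f := fun c => (of E x + of E y) * c)
      (g := fun c => of E x * c + of E y * c)
      (continuous_const.mul continuous_id)
      ((continuous_const.mul continuous_id).add (continuous_const.mul continuous_id))
  | h z => rw [← map_add, ← of_mul, ← of_mul, ← of_mul, ← map_add, add_mul]

theorem zero_mul_aux (a : GraphCStar E) : 0 * a = 0 := by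
  have h := add_mul_aux E 0 0 a
  rwa [add_zero, left_eq_add] at h

theorem mul_zero_aux (a : GraphCStar E) : a * 0 = 0 := by
  have h := mul_add_aux E a 0 0
  rwa [add_zero, left_eq_add] at h

instance : NonUnitalRing (GraphCStar E) where
  zero_mul := zero_mul_aux E
  mul_zero := mul_zero_aux E
  left_distrib := mul_add_aux E
  right_distrib := add_mul_aux E
  mul_assoc := mul_assoc_aux E

instance : NonUnitalNormedRing (GraphCStar E) where
  dist_eq := dist_eq_norm_neg_add
  norm_mul_le := norm_mul_le_aux E

instance : Star (GraphCStar E) where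
  star := Completion.map (star : PreGraphCStar E → PreGraphCStar E)

theorem of_star (x : PreGraphCStar E) : of E (star x) = star (of E x) :=
  (Completion.map_coe (starNormedAddGroupHom (E := PreGraphCStar E)).uniformContinuous x).symm

instance : ContinuousStar (GraphCStar E) where
  continuous_star := Completion.continuous_map

instance : InvolutiveStar (GraphCStar E) where
  star_involutive a := by
    induction a using GraphCStar.induction with
    | hP =>
      exact isClosed_setOf_eq E (f := fun a => star (star a)) (g := fun a => a)
        (continuous_star.comp continuous_star) continuous_id
    | h x => rw [← of_star, ← of_star, star_star]

theorem star_mul_aux (a b : GraphCStar E) : star (a * b) = star b * star a := by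
  induction a using GraphCStar.induction with
  | hP =>
    exact isClosed_setOf_eq E (f := fun a => star (a * b)) (g := fun a => star b * star a)
      (continuous_star.comp (continuous_id.mul continuous_const))
      (continuous_const.mul continuous_star)
  | h x =>
  induction b using GraphCStar.induction with
  | hP =>
    exact isClosed_setOf_eq E (f := fun b => star (of E x * b))
      (g := fun b => star b * star (of E x))
      (continuous_star.comp (continuous_const.mul continuous_id))
      (continuous_star.mul continuous_const)
  | h y => rw [← of_mul, ← of_star, ← of_star, ← of_star, ← of_mul, star_mul]

theorem star_add_aux (a b : GraphCStar E) : star (a + b) = star a + star b := by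
  induction a using GraphCStar.induction with
  | hP =>
    exact isClosed_setOf_eq E (f := fun a => star (a + b)) (g := fun a => star a + star b)
      (continuous_star.comp (continuous_id.add continuous_const))
      (continuous_star.add continuous_const)
  | h x =>
  induction b using GraphCStar.induction with
  | hP =>
    exact isClosed_setOf_eq E (f := fun b => star (of E x + b))
      (g := fun b => star (of E x) + star b)
      (continuous_star.comp (continuous_const.add continuous_id))
      (continuous_const.add continuous_star)
  | h y => rw [← map_add, ← of_star, ← of_star, ← of_star, ← map_add, star_add]

instance : StarRing (GraphCStar E) where
  star_mul := star_mul_aux E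
  star_add := star_add_aux E

instance : CStarRing (GraphCStar E) where
  norm_mul_self_le a := by
    induction a using GraphCStar.induction with
    | hP =>
      exact isClosed_le (f := fun a : GraphCStar E => ‖a‖ * ‖a‖)
        (g := fun a => ‖star a * a‖) (continuous_norm.mul continuous_norm)
        (continuous_star.mul continuous_id).norm
    | h x => rw [← of_star, ← of_mul, norm_of, norm_of, PreGraphCStar.norm_star_mul_self]

instance : IsScalarTower ℂ (GraphCStar E) (GraphCStar E) where
  smul_assoc c a b := by
    rw [smul_eq_mul, smul_eq_mul]
    induction a using GraphCStar.induction with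
    | hP =>
      exact isClosed_setOf_eq E (f := fun a => (c • a) * b) (g := fun a => c • (a * b))
        ((continuous_id.const_smul c).mul continuous_const)
        ((continuous_id.mul continuous_const).const_smul c)
    | h x =>
    induction b using GraphCStar.induction with
    | hP =>
      exact isClosed_setOf_eq E (f := fun b => (c • of E x) * b) (g := fun b => c • (of E x * b))
        (continuous_const.mul continuous_id)
        ((continuous_const.mul continuous_id).const_smul c)
    | h y => rw [← map_smul, ← of_mul, ← of_mul, ← map_smul, smul_mul_assoc]

instance : SMulCommClass ℂ (GraphCStar E) (GraphCStar E) where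
  smul_comm c a b := by
    rw [smul_eq_mul, smul_eq_mul]
    induction a using GraphCStar.induction with
    | hP =>
      exact isClosed_setOf_eq E (f := fun a => c • (a * b)) (g := fun a => a * (c • b))
        ((continuous_id.mul continuous_const).const_smul c)
        (continuous_id.mul continuous_const)
    | h x =>
    induction b using GraphCStar.induction with
    | hP =>
      exact isClosed_setOf_eq E (f := fun b => c • (of E x * b)) (g := fun b => of E x * (c • b))
        ((continuous_const.mul continuous_id).const_smul c)
        (continuous_const.mul (continuous_id.const_smul c))
    | h y => rw [← map_smul, ← of_mul, ← of_mul, ← map_smul, mul_smul_comm]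

instance : StarModule ℂ (GraphCStar E) where
  star_smul c a := by
    induction a using GraphCStar.induction with
    | hP =>
      exact isClosed_setOf_eq E (f := fun a => star (c • a)) (g := fun a => star c • star a)
        (continuous_star.comp (continuous_id.const_smul c)) (continuous_star.const_smul (star c))
    | h x => rw [← map_smul, ← of_star, ← of_star, ← map_smul, star_smul]

instance : NonUnitalCStarAlgebra (GraphCStar E) where

/-- The projection `p_v` in `C^*(E)`. -/
def p (v : V) : GraphCStar E := of E (LPA.p ℂ E v)

/-- The partial isometry `s_e` in `C^*(E)`. -/
def s (e : Ed) : GraphCStar E := of E (LPA.s ℂ E e)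

end GraphCStar

end

/-! ### Closed two-sided ideals -/

section ClosedIdeals

variable {A : Type*} [NonUnitalCStarAlgebra A]

/-- The closed two-sided ideal of the `C^*`-algebra `A` generated by `S`. -/
def closedIdealSpan (S : Set A) : Submodule ℂ A :=
  sInf {J | S ⊆ (J : Set A) ∧ IsTwoSidedIdeal ℂ J ∧ IsClosed (J : Set A)}

theorem subset_closedIdealSpan (S : Set A) : S ⊆ (closedIdealSpan S : Set A) := by
  intro x hx
  simp only [closedIdealSpan, SetLike.mem_coe, Submodule.mem_sInf]
  exact fun J hJ => hJ.1 hx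

theorem closedIdealSpan_le {S : Set A} {J : Submodule ℂ A} (h : S ⊆ (J : Set A))
    (hJ : IsTwoSidedIdeal ℂ J) (hc : IsClosed (J : Set A)) : closedIdealSpan S ≤ J :=
  sInf_le ⟨h, hJ, hc⟩

theorem isTwoSidedIdeal_closedIdealSpan (S : Set A) :
    IsTwoSidedIdeal ℂ (closedIdealSpan S) := by
  intro a x hx
  simp only [closedIdealSpan, Submodule.mem_sInf] at hx ⊢
  exact ⟨fun J hJ => (hJ.2.1 a x (hx J hJ)).1, fun J hJ => (hJ.2.1 a x (hx J hJ)).2⟩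

theorem isClosed_closedIdealSpan (S : Set A) : IsClosed (closedIdealSpan S : Set A) := by
  rw [closedIdealSpan, Submodule.coe_sInf]
  exact isClosed_biInter fun J hJ => hJ.2.2

theorem star_mem_closedIdealSpan {S : Set A} (hS : ∀ x ∈ S, star x ∈ S) {x : A}
    (hx : x ∈ closedIdealSpan S) : star x ∈ closedIdealSpan S :=
  closedIdealSpan_le (J := starIdeal (closedIdealSpan S))
    (fun y hy => subset_closedIdealSpan S (hS y hy))
    (isTwoSidedIdeal_starIdeal (isTwoSidedIdeal_closedIdealSpan S))
    ((isClosed_closedIdealSpan S).preimage continuous_star) hx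

end ClosedIdeals

namespace GraphCStar

variable {V Ed : Type*} (E : DirGraph V Ed)

theorem star_p (v : V) : star (p E v) = p E v :=
  (of_star E (LPA.p ℂ E v)).symm.trans (congrArg (of E) (LPA.star_p ℂ E v))

/-- A Cuntz-Krieger `E`-family in a `C^*`-algebra: mutually orthogonal projections `P v` and partial
isometries `S e` with mutually orthogonal ranges such that `Sₑ* Sₑ = P (r e)`,
`Sₑ Sₑ* ≤ P (s e)`, and `P v` is the sum of the `Sₑ Sₑ*` with `s e = v` if there are finitely many
such `e` and at least one. -/
structure IsCuntzKriegerFamily {B : Type*} [NonUnitalCStarAlgebra B] (P : V → B) (S : Ed → B) :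
    Prop where
  star_proj : ∀ v, star (P v) = P v
  idem : ∀ v, P v * P v = P v
  orth : ∀ v w, v ≠ w → P v * P w = 0
  isometry : ∀ e, S e * star (S e) * S e = S e
  orth_range : ∀ e f, e ≠ f → (S e * star (S e)) * (S f * star (S f)) = 0
  star_mul_self : ∀ e, star (S e) * S e = P (E.r e)
  range_le : ∀ e, P (E.s e) * (S e * star (S e)) = S e * star (S e)
  sum : ∀ v (F : Finset Ed), F.Nonempty → (∀ e, e ∈ F ↔ E.s e = v) →
    P v = ∑ e ∈ F, S e * star (S e)

theorem isCuntzKriegerFamily : IsCuntzKriegerFamily E (p E) (s E) := by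
  have hs (e : Ed) : star (s E e) = of E (LPA.sStar ℂ E e) :=
    (of_star E (LPA.s ℂ E e)).symm.trans (congrArg (of E) (LPA.star_s ℂ E e))
  have hm (x y z : LPA ℂ E) (h : x * y = z) : of E x * of E y = of E z :=
    (of_mul E x y).symm.trans (congrArg (of E) h)
  have h0 : of E (0 : LPA ℂ E) = 0 := map_zero (of E)
  have hr (e : Ed) : star (s E e) * s E e = p E (E.r e) := by
    rw [hs]; exact hm _ _ _ (LPA.sStar_mul_s ℂ E e)
  have hsp (e : Ed) : s E e * p E (E.r e) = s E e := hm _ _ _ (LPA.s_mul_p ℂ E e)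
  refine ⟨star_p E, fun v => hm _ _ _ (LPA.p_mul_p ℂ E v),
    fun v w h => (hm _ _ _ (LPA.p_mul_p_of_ne ℂ E h)).trans h0, fun e => ?_, fun e f h => ?_, hr,
    fun e => ?_, fun v F hne hF => ?_⟩
  · rw [mul_assoc, hr, hsp]
  · have : star (s E e) * s E f = 0 := by
      rw [hs]; exact (hm _ _ _ (LPA.sStar_mul_s_of_ne ℂ E h)).trans h0
    rw [mul_assoc, ← mul_assoc (star (s E e)), this, zero_mul, mul_zero]
  · have : p E (E.s e) * s E e = s E e := hm _ _ _ (LPA.p_mul_s ℂ E e)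
    rw [← mul_assoc, this]
  · refine (congrArg (of E) (LPA.p_eq_sum ℂ E v F hne hF)).trans ?_
    refine (map_sum (of E) _ F).trans (Finset.sum_congr rfl fun e _ => ?_)
    rw [hs]
    exact of_mul E _ _

/-- The universal property of `C^*(E)`: each Cuntz-Krieger `E`-family in a `C^*`-algebra is the image
of the canonical one under a unique `*`-homomorphism. -/
theorem existsUnique_lift {B : Type*} [NonUnitalCStarAlgebra B] {P : V → B} {S : Ed → B}
    (h : IsCuntzKriegerFamily E P S) :
    ∃! φ : GraphCStar E →⋆ₙₐ[ℂ] B, (∀ v, φ (p E v) = P v) ∧ ∀ e, φ (s E e) = S e := by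
  have hps (e : Ed) : P (E.s e) * S e = S e := by
    rw [← h.isometry e, ← mul_assoc, h.range_le]
  have hsp (e : Ed) : S e * P (E.r e) = S e := by
    rw [← h.star_mul_self, ← mul_assoc, h.isometry]
  obtain ⟨ψ, ⟨hp, hs, hs'⟩, -⟩ := LPA.existsUnique_lift ℂ E P S (fun e => star (S e)) h.idem h.orth
    hps hsp (fun e => by simpa [h.star_proj] using congrArg star (hsp e))
    (fun e => by simpa [h.star_proj] using congrArg star (hps e)) h.star_mul_self
    (fun e f hef => by
      have h1 : star (S e) = star (S e) * (S e * star (S e)) := by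
        simpa [mul_assoc] using (congrArg star (h.isometry e)).symm
      rw [h1, ← h.isometry f, mul_assoc (star (S e)), ← mul_assoc (S e * star (S e)),
        h.orth_range e f hef, zero_mul, mul_zero]) h.sum
  have hstar (a : LPA ℂ E) : ψ (star a) = star (ψ a) := by
    induction a using LPA.induction with
    | hp v => rw [LPA.star_p, hp, h.star_proj]
    | hs e => rw [LPA.star_s, hs, hs']
    | hsStar e => rw [LPA.star_sStar, hs, hs', star_star]
    | hzero => simp
    | hadd a b ha hb => rw [star_add, map_add, map_add, ha, hb, star_add]
    | hmul a b ha hb => rw [star_mul, map_mul, map_mul, ha, hb, star_mul]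
    | hsmul c a ha => rw [star_smul, map_smul, map_smul, ha, star_smul]
  let N : Seminorm ℂ (LPA ℂ E) := (normSeminorm ℂ B).comp (ψ : LPA ℂ E →ₗ[ℂ] B)
  have hN (a : LPA ℂ E) : N a = ‖ψ a‖ := rfl
  have hNc : IsCStarSeminorm N := by
    refine ⟨fun x y => ?_, fun x => ?_⟩
    · simp only [hN, map_mul]
      exact norm_mul_le _ _
    · simp only [hN, map_mul, hstar, CStarRing.norm_star_mul_self, sq]
  have hle (a : PreGraphCStar E) : ‖ψ a‖ ≤ ‖a‖ :=
    le_univCStarSeminorm (bddAbove_cStarSeminorm E) hNc a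
  let ψ' : PreGraphCStar E →+ B := ⟨⟨ψ, map_zero ψ⟩, map_add ψ⟩
  have huc : UniformContinuous ψ' :=
    (AddMonoidHomClass.lipschitz_of_bound ψ' 1 (fun a => by rw [one_mul]; exact hle a)).uniformContinuous
  let f : GraphCStar E → B := Completion.extension ψ'
  have hf (x : PreGraphCStar E) : f (of E x) = ψ x := Completion.extension_coe huc x
  have hfc : Continuous f := Completion.continuous_extension
  let φ : GraphCStar E →⋆ₙₐ[ℂ] B :=
    { toFun := f
      map_smul' := fun c a => by
        induction a using GraphCStar.induction with
        | hP =>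
          exact isClosed_eq (f := fun a => f (c • a)) (g := fun a => c • f a)
            (hfc.comp (continuous_id.const_smul c)) (hfc.const_smul c)
        | h x => rw [← map_smul, hf, hf]; exact map_smul ψ c x
      map_zero' := by rw [← map_zero (of E), hf]; exact map_zero ψ
      map_add' := fun a b => by
        induction a using GraphCStar.induction with
        | hP =>
          exact isClosed_eq (f := fun a => f (a + b)) (g := fun a => f a + f b)
            (hfc.comp (continuous_id.add continuous_const)) (hfc.add continuous_const)
        | h x =>
        induction b using GraphCStar.induction with
        | hP =>
          exact isClosed_eq (f := fun b => f (of E x + b)) (g := fun b => f (of E x) + f b)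
            (hfc.comp (continuous_const.add continuous_id)) (continuous_const.add hfc)
        | h y => rw [← map_add, hf, hf, hf]; exact map_add ψ x y
      map_mul' := fun a b => by
        induction a using GraphCStar.induction with
        | hP =>
          exact isClosed_eq (f := fun a => f (a * b)) (g := fun a => f a * f b)
            (hfc.comp (continuous_id.mul continuous_const)) (hfc.mul continuous_const)
        | h x =>
        induction b using GraphCStar.induction with
        | hP =>
          exact isClosed_eq (f := fun b => f (of E x * b)) (g := fun b => f (of E x) * f b)
            (hfc.comp (continuous_const.mul continuous_id)) (continuous_const.mul hfc)
        | h y => rw [← of_mul, hf, hf, hf]; exact map_mul ψ x y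
      map_star' := fun a => by
        induction a using GraphCStar.induction with
        | hP =>
          exact isClosed_eq (f := fun a => f (star a)) (g := fun a => star (f a))
            (hfc.comp continuous_star) hfc.star
        | h x => rw [← of_star, hf, hf]; exact hstar x }
  have hφ (x : PreGraphCStar E) : φ (of E x) = ψ x := hf x
  refine ⟨φ, ⟨fun v => (hφ _).trans (hp v), fun e => (hφ _).trans (hs e)⟩, fun φ' h' => ?_⟩
  have hkey (x : LPA ℂ E) : φ' (of E x) = φ (of E x) := by
    have hcomp : φ' (of E x) = ψ x := by
      induction x using LPA.induction with
      | hp v => exact (h'.1 v).trans (hp v).symm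
      | hs e => exact (h'.2 e).trans (hs e).symm
      | hsStar e =>
        rw [← LPA.star_s, hstar, hs]
        exact (congrArg φ' (of_star E (LPA.s ℂ E e))).trans ((map_star φ' _).trans
          (congrArg star (h'.2 e)))
      | hzero => exact (congrArg φ' (map_zero (of E))).trans ((map_zero φ').trans (map_zero ψ).symm)
      | hadd a b ha hb =>
        rw [map_add, ← ha, ← hb, ← map_add]
        exact congrArg φ' (map_add (of E) a b)
      | hmul a b ha hb =>
        rw [map_mul, ← ha, ← hb, ← map_mul]
        exact congrArg φ' (of_mul E a b)
      | hsmul c a ha =>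
        rw [map_smul, ← ha, ← map_smul]
        exact congrArg φ' (map_smul (of E) c a)
    exact hcomp.trans (hφ x).symm
  ext a
  have hc' : Continuous φ' := AddMonoidHomClass.continuous_of_bound φ' 1 fun a => by
    rw [one_mul]; exact NonUnitalStarAlgHom.norm_apply_le φ' a
  induction a using GraphCStar.induction with
  | hP => exact isClosed_eq hc' hfc
  | h x => exact hkey x

/-- The closed two-sided ideal of `C^*(E)` generated by the `p_v`, `v ∈ H`. -/
def vertexIdeal (H : Set V) : NonUnitalStarSubalgebra ℂ (GraphCStar E) where
  toSubmodule := closedIdealSpan (p E '' H)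
  mul_mem' {a b} _ hb := (isTwoSidedIdeal_closedIdealSpan (p E '' H) a b hb).1
  star_mem' hx := star_mem_closedIdealSpan
    (by rintro _ ⟨v, hv, rfl⟩; exact ⟨v, hv, (star_p E v).symm⟩) hx

end GraphCStar

end

noncomputable section

/-! ### Paths -/

namespace DirGraph

variable {V Ed : Type*} {E : DirGraph V Ed}

/-! Write $H=T(v)$. Since $v$ is a line point, each vertex of $H$ emits at most one edge and no
cycle is based in $H$, so for every $w\in H$ there is exactly one path from $v$ to $w$
(`IsLinePoint.path_unique`). Let $t_w$ be its path element (`linkElt`). Always $t_w^*t_w=p_w$; and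
because a vertex with a single edge $e$ satisfies $s_es_e^*=p_{s(e)}$, also $t_wt_w^*=p_v$. Thus all
$p_w$, $w\in H$, are equivalent to $p_v$.

For $\alpha\in\Lambda$ put $u_\alpha=s_\alpha t_{r(\alpha)}^*$ (`unitElt`). Then
$u_\alpha^*u_\beta=\delta_{\alpha\beta}p_v$, so the $u_\alpha u_\beta^*$ multiply as matrix units.
Left multiplication by a generator sends each $u_\alpha$ to some $u_\beta$ or to $0$. The rule is
the relation `Step`: prefix an edge, except that an edge starting in $H$ moves one vertex of $H$ to
another. Hence the span of the matrix units is a two-sided ideal. It contains $p_w=u_wu_w^*$ for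
$w\in H$ and lies in $I_H$, so it is $I_H$ (`range_ofMatrix`). The map from matrices is injective
because $u_\alpha^*Au_\beta=A_{\alpha\beta}p_v$ and $p_v\neq 0$.

That $p_v\ne0$ is seen in a representation: `Step e` is a partial injection of $\Lambda$, and these
partial injections satisfy the relations of the graph. They act on all functions on $\Lambda$
(giving `p_ne_zero_of_mem`), and as partial isometries on $\ell^2(\Lambda)$ (giving `lineRep`).

For the $C^*$-algebra, $\mathcal I_H$ is contained in the closure of the span of the matrix units,
and `lineRep` takes $u_\alpha u_\beta^*$ to the rank one operator
$\delta_\alpha\otimes\delta_\beta^*$. So $\mathcal I_H$ acts by compact operators. The kernel on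
$\mathcal I_H$ is zero, because $u_\alpha^*xu_\beta$ is a multiple of $p_v$, and $p_v$ is not killed
(`eq_zero_of_lineRep_eq_zero`). An injective $*$-homomorphism of $C^*$-algebras has closed range,
and a closed subspace containing those rank one operators contains all compact operators. -/

theorem isPathFrom_append {w : V} {l m : List Ed} :
    E.IsPathFrom w (l ++ m) ↔ E.IsPathFrom w l ∧ E.IsPathFrom (E.endVertex w l) m := by
  induction l generalizing w with
  | nil => simp [IsPathFrom, endVertex]
  | cons e l ih => simp [IsPathFrom, endVertex, ih, and_assoc]

theorem endVertex_append {w : V} {l m : List Ed} :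
    E.endVertex w (l ++ m) = E.endVertex (E.endVertex w l) m := by
  induction l generalizing w with
  | nil => simp [endVertex]
  | cons e l ih => simp [endVertex, ih]

theorem mem_reach_iff {v w : V} :
    w ∈ E.reach v ↔ ∃ l : List Ed, E.IsPathFrom v l ∧ E.endVertex v l = w := by
  constructor
  · rintro ⟨⟨x, l, h⟩, rfl, rfl⟩
    exact ⟨l, h, rfl⟩
  · rintro ⟨l, h, rfl⟩
    exact ⟨⟨v, l, h⟩, rfl, rfl⟩

theorem mem_reach_self (v : V) : v ∈ E.reach v := mem_reach_iff.2 ⟨[], trivial, rfl⟩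

theorem reach_trans {v w x : V} (h : w ∈ E.reach v) (h' : x ∈ E.reach w) : x ∈ E.reach v := by
  obtain ⟨l, hl, rfl⟩ := mem_reach_iff.1 h
  obtain ⟨m, hm, rfl⟩ := mem_reach_iff.1 h'
  exact mem_reach_iff.2 ⟨l ++ m, isPathFrom_append.2 ⟨hl, hm⟩, endVertex_append⟩

theorem r_mem_reach (e : Ed) : E.r e ∈ E.reach (E.s e) := mem_reach_iff.2 ⟨[e], ⟨rfl, trivial⟩, rfl⟩

theorem isHereditary_reach (v : V) : E.IsHereditary (E.reach v) :=
  fun e he => reach_trans he (r_mem_reach e)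

theorem IsLinePoint.of_mem_reach {v w : V} (hv : E.IsLinePoint v) (hw : w ∈ E.reach v) :
    E.IsLinePoint w :=
  ⟨fun x hx => hv.1 x (reach_trans hw hx), fun α hα h => hv.2 α hα (reach_trans hw h)⟩

theorem IsLinePoint.eq_nil {v : V} (hv : E.IsLinePoint v) {l : List Ed} (hl : E.IsPathFrom v l)
    (h : E.endVertex v l = v) : l = [] := by
  by_contra hne
  exact hv.2 ⟨v, l, hl⟩ ⟨hne, h.symm⟩ (mem_reach_self v)

/-- From a line point there is at most one path to each vertex. -/
theorem IsLinePoint.path_unique {v : V} (hv : E.IsLinePoint v) {l m : List Ed}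
    (hl : E.IsPathFrom v l) (hm : E.IsPathFrom v m) (h : E.endVertex v l = E.endVertex v m) :
    l = m := by
  induction l generalizing v m with
  -- Neither path can continue beyond the end of the other: the excess would be a cycle.
  | nil => exact (hv.eq_nil hm h.symm).symm
  | cons e l ih =>
    cases m with
    | nil => exact hv.eq_nil hl h
    | cons f m =>
      obtain ⟨he, hl⟩ := hl
      obtain ⟨hf, hm⟩ := hm
      have hef : e = f := by
        by_contra hne
        exact hv.1 v (mem_reach_self v) ⟨e, f, hne, he, hf⟩
      subst hef
      have hr : E.r e ∈ E.reach v := he ▸ r_mem_reach e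
      rw [ih (hv.of_mem_reach hr) hl hm h]

variable {H : Set V}

theorem IsHereditary.s_mem_of_mem_getLast? (hH : E.IsHereditary H) {w : V} (hw : w ∈ H)
    {l : List Ed} (hl : E.IsPathFrom w l) {e : Ed} (he : e ∈ l.getLast?) : E.s e ∈ H := by
  induction l generalizing w with
  | nil => simp at he
  | cons f l ih =>
    have hf : E.s f ∈ H := hl.1.symm ▸ hw
    cases l with
    | nil =>
      simp only [List.getLast?_singleton, Option.mem_def, Option.some.injEq] at he
      exact he ▸ hf
    | cons g l => exact ih (hH f hf) hl.2 (by simpa using he)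

/-- A path that starts in a hereditary set stays there, so its last edge would start in `H`, which
entry paths forbid. Hence the entry paths starting in `H` are exactly the vertices of `H`. -/
theorem IsHereditary.edges_eq_nil (hH : E.IsHereditary H) (α : E.EntryPaths H)
    (h : α.1.source ∈ H) : α.1.edges = [] := by
  by_contra hne
  obtain ⟨e, he⟩ := Option.isSome_iff_exists.1 (List.getLast?_isSome.2 hne)
  exact α.2.2 e he (hH.s_mem_of_mem_getLast? h α.1.isPath he)

/-! ### Partial injections of the index set given by the edges -/

namespace EntryPaths

theorem ext {α β : E.EntryPaths H} (h : α.1.source = β.1.source) (h' : α.1.edges = β.1.edges) :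
    α = β := Subtype.ext (FinPath.ext h h')

theorem source_mem {α : E.EntryPaths H} (h : α.1.edges = []) : α.1.source ∈ H := by
  have := α.2.1
  rwa [FinPath.range, h] at this

/-- A vertex of `H`, as a path of length `0`. -/
def vertex (w : V) (hw : w ∈ H) : E.EntryPaths H := ⟨⟨w, [], trivial⟩, hw, by simp⟩

/-- The partial action of the edges on `EntryPaths H`: the edge `e` is put in front of a path; if
`e` starts in `H`, it takes the path `r e` of length `0` to `s e`. -/
def Step (e : Ed) (α β : E.EntryPaths H) : Prop :=
  α.1.source = E.r e ∧ β.1.source = E.s e ∧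
    (β.1.edges = e :: α.1.edges ∨ (α.1.edges = [] ∧ β.1.edges = []))

theorem s_notMem {α : E.EntryPaths H} (hH : E.IsHereditary H) {e : Ed} {l : List Ed}
    (h : α.1.edges = e :: l) : E.s e ∉ H := by
  intro he
  have h1 : α.1.source = E.s e := by
    have := α.1.isPath
    rw [h] at this
    exact this.1.symm
  have := hH.edges_eq_nil α (h1 ▸ he)
  simp [h] at this

theorem Step.left_unique {e : Ed} {α α' β : E.EntryPaths H} (h : Step e α β) (h' : Step e α' β) :
    α = α' := by
  refine ext (h.1.trans h'.1.symm) ?_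
  obtain ⟨-, -, h | h⟩ := h <;> obtain ⟨-, -, h' | h'⟩ := h' <;> simp_all

/-- The two alternatives in `Step` exclude each other: a result beginning with `e` forces `s e ∉ H`,
a result of length `0` forces `s e ∈ H`. -/
theorem Step.right_unique (hH : E.IsHereditary H) {e : Ed} {α β β' : E.EntryPaths H}
    (h : Step e α β) (h' : Step e α β') : β = β' := by
  refine ext (h.2.1.trans h'.2.1.symm) ?_
  obtain ⟨-, hs, h⟩ := h
  obtain ⟨-, hs', h'⟩ := h'
  rcases h with h | h <;> rcases h' with h' | h'
  · rw [h, h']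
  · exact absurd (hs' ▸ source_mem h'.2) (s_notMem hH h)
  · exact absurd (hs ▸ source_mem h.2) (s_notMem hH h')
  · rw [h.2, h'.2]

/-- The ranges of different edges are disjoint: a nonempty `β` determines `e` as its first edge, and
for `β` a vertex of `H` only one edge starts there. -/
theorem Step.edge_unique (hb : ∀ w ∈ H, ¬ E.IsBifurcation w) {e f : Ed}
    {α α' β : E.EntryPaths H} (h : Step e α β) (h' : Step f α' β) : e = f := by
  obtain ⟨-, hs, h⟩ := h
  obtain ⟨-, hs', h'⟩ := h'
  rcases h with h | h <;> rcases h' with h' | h'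
  · simp_all
  · simp_all
  · simp_all
  · by_contra hne
    exact hb _ (source_mem h.2) ⟨e, f, hne, hs.symm, hs'.symm⟩

theorem exists_step (e : Ed) (α : E.EntryPaths H) (h : α.1.source = E.r e) :
    ∃ β, Step e α β := by
  by_cases hc : α.1.edges = [] ∧ E.s e ∈ H
  · exact ⟨vertex (E.s e) hc.2, h, rfl, Or.inr ⟨hc.1, rfl⟩⟩
  · refine ⟨⟨⟨E.s e, e :: α.1.edges, rfl, h ▸ α.1.isPath⟩, ?_, ?_⟩, h, rfl, Or.inl rfl⟩
    · have := α.2.1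
      rwa [FinPath.range, h] at this
    · intro f hf
      rcases hl : α.1.edges with _ | ⟨g, l⟩
      · simp only [hl, List.getLast?_singleton, Option.mem_def, Option.some.injEq] at hf
        exact fun h' => hc ⟨hl, hf ▸ h'⟩
      · exact α.2.2 f (by simpa [hl] using hf)

theorem exists_step_of_cons {β : E.EntryPaths H} {e : Ed} {l : List Ed}
    (h : β.1.edges = e :: l) : ∃ α, Step e α β ∧ α.1.edges = l := by
  have hp := β.1.isPath
  have hr := β.2.1
  have hl := β.2.2
  simp only [FinPath.range, h, IsPathFrom, endVertex] at hp hr hl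
  refine ⟨⟨⟨E.r e, l, hp.2⟩, hr, fun f hf => hl f ?_⟩, ⟨rfl, hp.1.symm, Or.inl h⟩, rfl⟩
  cases l with
  | nil => simp at hf
  | cons g l => simpa using hf

theorem exists_step_of_nil (hH : E.IsHereditary H) {β : E.EntryPaths H} {e : Ed}
    (h : β.1.edges = []) (he : E.s e = β.1.source) : ∃ α, Step e α β :=
  ⟨vertex (E.r e) (hH e (he ▸ source_mem h)), rfl, he.symm, Or.inr ⟨rfl, h⟩⟩

end EntryPaths

end DirGraph

/-! ### Path elements of the Leavitt path algebra -/

namespace LPA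

open DirGraph

variable (k : Type*) [Field k] {V Ed : Type*} (E : DirGraph V Ed)

/-- The element `s_{e₁} ⋯ s_{eₙ}` of `L_k(E)`, and `p_w` for the path of length `0`. -/
def pathElt : V → List Ed → LPA k E
  | w, [] => p k E w
  | _, e :: l => s k E e * pathElt (E.r e) l

variable {k E}

theorem p_mul_pathElt {w : V} {l : List Ed} (h : E.IsPathFrom w l) :
    p k E w * pathElt k E w l = pathElt k E w l := by
  cases l with
  | nil => exact p_mul_p k E w
  | cons e l => rw [pathElt, ← mul_assoc, ← h.1, p_mul_s]

theorem pathElt_mul_p {w : V} {l : List Ed} :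
    pathElt k E w l * p k E (E.endVertex w l) = pathElt k E w l := by
  induction l generalizing w with
  | nil => exact p_mul_p k E w
  | cons e l ih => rw [pathElt, mul_assoc, endVertex, ih]

theorem pathElt_append {w : V} {l m : List Ed} (h : E.IsPathFrom (E.endVertex w l) m) :
    pathElt k E w (l ++ m) = pathElt k E w l * pathElt k E (E.endVertex w l) m := by
  induction l generalizing w with
  | nil => exact (p_mul_pathElt h).symm
  | cons e l ih => rw [List.cons_append, pathElt, ih h, pathElt, mul_assoc, endVertex]

/-- The edge `e` is the only one at its source, so the summation relation there has one term. -/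
theorem s_mul_sStar {e : Ed} (h : ¬ E.IsBifurcation (E.s e)) :
    s k E e * sStar k E e = p k E (E.s e) := by
  rw [p_eq_sum k E (E.s e) {e} (by simp) fun f => ?_, Finset.sum_singleton]
  rw [Finset.mem_singleton]
  refine ⟨fun hf => hf ▸ rfl, fun hf => ?_⟩
  by_contra hne
  exact h ⟨f, e, hne, hf, rfl⟩

variable (k) in
/-- The path element of a path from `v` to `w`. -/
def linkElt (v w : V) (h : w ∈ E.reach v) : LPA k E := pathElt k E v (mem_reach_iff.1 h).choose

/-- Uniqueness of paths makes the choice in `linkElt` immaterial. -/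
theorem linkElt_eq {v w : V} (hv : E.IsLinePoint v) {l : List Ed} (hl : E.IsPathFrom v l)
    (h : E.endVertex v l = w) :
    linkElt k v w (mem_reach_iff.2 ⟨l, hl, h⟩) = pathElt k E v l := by
  have := (mem_reach_iff.1 (mem_reach_iff.2 ⟨l, hl, h⟩)).choose_spec
  rw [linkElt, hv.path_unique this.1 hl (this.2.trans h.symm)]

theorem linkElt_mul_p {v w : V} (h : w ∈ E.reach v) :
    linkElt k v w h * p k E w = linkElt k v w h := by
  have := pathElt_mul_p (k := k) (E := E) (w := v) (l := (mem_reach_iff.1 h).choose)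
  rwa [(mem_reach_iff.1 h).choose_spec.2] at this

theorem p_mul_linkElt {v w : V} (h : w ∈ E.reach v) :
    p k E v * linkElt k v w h = linkElt k v w h :=
  p_mul_pathElt (mem_reach_iff.1 h).choose_spec.1

theorem linkElt_mul_s {v : V} (hv : E.IsLinePoint v) {e : Ed} (h : E.s e ∈ E.reach v) :
    linkElt k v (E.s e) h * s k E e = linkElt k v (E.r e) (isHereditary_reach v e h) := by
  obtain ⟨l, hl, he⟩ := mem_reach_iff.1 h
  have hp : E.IsPathFrom v (l ++ [e]) := isPathFrom_append.2 ⟨hl, he.symm, trivial⟩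
  rw [linkElt_eq hv hl he, linkElt_eq hv hp (by simp [endVertex_append, endVertex]),
    pathElt_append (show E.IsPathFrom _ [e] from ⟨he.symm, trivial⟩)]
  simp [pathElt, s_mul_p]

variable [StarRing k]

theorem star_pathElt_mul_self {w : V} {l : List Ed} (h : E.IsPathFrom w l) :
    star (pathElt k E w l) * pathElt k E w l = p k E (E.endVertex w l) := by
  induction l generalizing w with
  | nil => rw [pathElt, star_p, p_mul_p, endVertex]
  | cons e l ih =>
    rw [pathElt, star_mul, star_s, mul_assoc, ← mul_assoc (sStar k E e), sStar_mul_s,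
      p_mul_pathElt h.2, ih h.2, endVertex]

theorem sStar_mul_p (e : Ed) : sStar k E e * p k E (E.s e) = sStar k E e := by
  simpa [star_mul, star_p, star_s] using congrArg star (p_mul_s k E e)

theorem p_mul_sStar (e : Ed) : p k E (E.r e) * sStar k E e = sStar k E e := by
  simpa [star_mul, star_p, star_s] using congrArg star (s_mul_p k E e)

/-- The product telescopes from the inside: with no bifurcations along the path, each `s_e s_e^*` is
the full vertex projection. -/
theorem pathElt_mul_star_self {w : V} {l : List Ed} (h : E.IsPathFrom w l)
    (hb : ∀ x ∈ E.reach w, ¬ E.IsBifurcation x) :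
    pathElt k E w l * star (pathElt k E w l) = p k E w := by
  induction l generalizing w with
  | nil => rw [pathElt, star_p, p_mul_p]
  | cons e l ih =>
    have hw := h.1
    subst hw
    rw [pathElt, star_mul, star_s, mul_assoc, ← mul_assoc _ _ (sStar k E e),
      ih h.2 fun x hx => hb x (reach_trans (r_mem_reach e) hx), p_mul_sStar,
      s_mul_sStar (hb _ (mem_reach_self _))]

/-! ### The generators of the ideal of a line point -/

variable (k) in
/-- The element `s_α t^*` for an entry path `α` of `T(v)`, where `t` is the path element of the path
from `v` to the range of `α`. -/
def unitElt {v : V} (α : E.EntryPaths (E.reach v)) : LPA k E :=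
  pathElt k E α.1.source α.1.edges * star (linkElt k v α.1.range α.2.1)

open EntryPaths

variable {v : V}

theorem p_mul_star_linkElt {w : V} (h : w ∈ E.reach v) :
    p k E w * star (linkElt k v w h) = star (linkElt k v w h) := by
  simpa [star_mul, star_p] using congrArg star (linkElt_mul_p (k := k) h)

theorem star_linkElt_mul_p {w : V} (h : w ∈ E.reach v) :
    star (linkElt k v w h) * p k E v = star (linkElt k v w h) := by
  simpa [star_mul, star_p] using congrArg star (p_mul_linkElt (k := k) h)

theorem star_linkElt_mul_self {w : V} (h : w ∈ E.reach v) :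
    star (linkElt k v w h) * linkElt k v w h = p k E w := by
  have := (mem_reach_iff.1 h).choose_spec
  rw [linkElt, star_pathElt_mul_self this.1, this.2]

theorem linkElt_mul_star_self (hv : E.IsLinePoint v) {w : V} (h : w ∈ E.reach v) :
    linkElt k v w h * star (linkElt k v w h) = p k E v :=
  pathElt_mul_star_self (mem_reach_iff.1 h).choose_spec.1 hv.1

variable {α β : E.EntryPaths (E.reach v)}

theorem unitElt_of_nil (h : α.1.edges = []) :
    unitElt k α = star (linkElt k v α.1.source (source_mem h)) := by
  obtain ⟨⟨w, l, hl⟩, hr, hα⟩ := α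
  obtain rfl : l = [] := h
  exact p_mul_star_linkElt _

theorem p_mul_unitElt (α : E.EntryPaths (E.reach v)) :
    p k E α.1.source * unitElt k α = unitElt k α := by
  rw [unitElt, ← mul_assoc, p_mul_pathElt α.1.isPath]

theorem unitElt_mul_p (α : E.EntryPaths (E.reach v)) : unitElt k α * p k E v = unitElt k α := by
  rw [unitElt, mul_assoc, star_linkElt_mul_p]

theorem p_mul_unitElt_of_ne {w : V} (h : w ≠ α.1.source) : p k E w * unitElt k α = 0 := by
  rw [← p_mul_unitElt, ← mul_assoc, p_mul_p_of_ne k E h, zero_mul]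

/-- For a genuine prefix this is associativity. For an edge inside `T(v)`, the relation `t_{r(e)} =
t_{s(e)} s_e` gives `s_e t_{r(e)}^* = s_e s_e^* t_{s(e)}^* = t_{s(e)}^*`. -/
theorem s_mul_unitElt (hv : E.IsLinePoint v) {e : Ed} (h : Step e α β) :
    s k E e * unitElt k α = unitElt k β := by
  obtain ⟨hr, hs, h | ⟨h, h'⟩⟩ := h
  · obtain ⟨⟨w, l, hl⟩, hα⟩ := α
    obtain ⟨⟨x, m, hm⟩, hβ⟩ := β
    obtain rfl : w = E.r e := hr
    obtain rfl : x = E.s e := hs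
    obtain rfl : m = e :: l := h
    exact (mul_assoc _ _ _).symm
  · rw [unitElt_of_nil h, unitElt_of_nil h']
    obtain ⟨⟨w, l, hl⟩, hα⟩ := α
    obtain ⟨⟨x, m, hm⟩, hβ⟩ := β
    obtain rfl : w = E.r e := hr
    obtain rfl : x = E.s e := hs
    have hx : E.s e ∈ E.reach v := source_mem h'
    rw [← linkElt_mul_s hv hx, star_mul, star_s, ← mul_assoc, s_mul_sStar (hv.1 _ hx),
      p_mul_star_linkElt]

theorem s_mul_unitElt_of_ne {e : Ed} (h : E.r e ≠ α.1.source) : s k E e * unitElt k α = 0 := by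
  rw [← s_mul_p, mul_assoc, p_mul_unitElt_of_ne h, mul_zero]

theorem sStar_mul_unitElt (hv : E.IsLinePoint v) {e : Ed} (h : Step e α β) :
    sStar k E e * unitElt k β = unitElt k α := by
  rw [← s_mul_unitElt hv h, ← mul_assoc, sStar_mul_s, ← h.1, p_mul_unitElt]

/-- If `β` is a vertex, `e` does not start there, since otherwise `r e` would be a predecessor; if
`β` has a first edge, it differs from `e` and `s_e^* s_f = 0` applies. -/
theorem sStar_mul_unitElt_of_not_exists (hv : E.IsLinePoint v) {e : Ed}
    (h : ¬ ∃ α, Step e α β) : sStar k E e * unitElt k β = 0 := by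
  rcases hβ : β.1.edges with _ | ⟨f, l⟩
  · have : E.s e ≠ β.1.source := fun h' => h (exists_step_of_nil (isHereditary_reach v) hβ h')
    rw [← sStar_mul_p, mul_assoc, p_mul_unitElt_of_ne this, mul_zero]
  · obtain ⟨α, hα, -⟩ := exists_step_of_cons hβ
    have hef : e ≠ f := fun h' => h ⟨α, h' ▸ hα⟩
    rw [← s_mul_unitElt hv hα, ← mul_assoc, sStar_mul_s_of_ne k E hef, zero_mul]

/-- Equal sources would put the source of `β` in `T(v)`, making `β` the same vertex as `α`;
different sources have orthogonal vertex projections. -/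
theorem star_unitElt_mul_unitElt_of_nil (hα : α.1.edges = [])
    (hne : α ≠ β) : star (unitElt k α) * unitElt k β = 0 := by
  by_cases h : α.1.source = β.1.source
  · have hβ := (isHereditary_reach v).edges_eq_nil β (h ▸ source_mem hα)
    exact absurd (EntryPaths.ext h (hα.trans hβ.symm)) hne
  · rw [← p_mul_unitElt α, star_mul, star_p, mul_assoc, p_mul_unitElt_of_ne h, mul_zero]

theorem star_unitElt_mul_self (α : E.EntryPaths (E.reach v)) (hv : E.IsLinePoint v) :
    star (unitElt k α) * unitElt k α = p k E v := by
  rw [unitElt, star_mul, star_star, mul_assoc, ← mul_assoc (star (pathElt _ _ _ _)),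
    star_pathElt_mul_self α.1.isPath]
  change _ * (p k E α.1.range * _) = _
  rw [p_mul_star_linkElt, linkElt_mul_star_self hv]

/-- Induction on the length of `α`: its first edge `e` is moved across as `s_e^*`, which either
kills `u_β` or replaces `β` by its predecessor, still different from that of `α`. -/
theorem star_unitElt_mul_unitElt_of_ne (hv : E.IsLinePoint v) (hne : α ≠ β) :
    star (unitElt k α) * unitElt k β = 0 := by
  induction hl : α.1.edges generalizing α β with
  | nil => exact star_unitElt_mul_unitElt_of_nil hl hne
  | cons e l ih =>
    obtain ⟨α', h, hl'⟩ := exists_step_of_cons hl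
    rw [← s_mul_unitElt hv h, star_mul, star_s, mul_assoc]
    by_cases hβ : ∃ β', Step e β' β
    · obtain ⟨β', hβ'⟩ := hβ
      rw [sStar_mul_unitElt hv hβ']
      refine ih (fun h' => hne ?_) hl'
      exact h.right_unique (isHereditary_reach v) (h' ▸ hβ')
    · rw [sStar_mul_unitElt_of_not_exists hv hβ, mul_zero]

end LPA

/-! ### Operators given by partial injections -/

namespace PEquiv

variable {α β γ : Type*}

/-- The partial equivalence with a given graph. -/
def ofRel (R : α → β → Prop) (hl : ∀ a a' b, R a b → R a' b → a = a')
    (hr : ∀ a b b', R a b → R a b' → b = b') : α ≃. β where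
  toFun a := open Classical in if h : ∃ b, R a b then some h.choose else none
  invFun b := open Classical in if h : ∃ a, R a b then some h.choose else none
  inv a b := by
    have h1 : (open Classical in
        a ∈ (if h : ∃ a, R a b then some h.choose else none : Option α)) ↔ R a b := by
      split_ifs with h
      · rw [Option.mem_some]
        exact ⟨fun h' => h' ▸ h.choose_spec, fun h' => hl _ _ _ h.choose_spec h'⟩
      · simpa using fun h' => h ⟨a, h'⟩
    have h2 : (open Classical in
        b ∈ (if h : ∃ b, R a b then some h.choose else none : Option β)) ↔ R a b := by
      split_ifs with h
      · rw [Option.mem_some]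
        exact ⟨fun h' => h' ▸ h.choose_spec, fun h' => hr _ _ _ h.choose_spec h'⟩
      · simpa using fun h' => h ⟨b, h'⟩
    exact h1.trans h2.symm

theorem mem_ofRel {R : α → β → Prop} {hl : ∀ a a' b, R a b → R a' b → a = a'}
    {hr : ∀ a b b', R a b → R a b' → b = b'} {a : α} {b : β} :
    b ∈ ofRel R hl hr a ↔ R a b := by
  classical
  change b ∈ (if h : ∃ b, R a b then some h.choose else none : Option β) ↔ _
  split_ifs with h
  · rw [Option.mem_some]
    exact ⟨fun h' => h' ▸ h.choose_spec, fun h' => hr _ _ _ h.choose_spec h'⟩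
  · simpa using fun h' => h ⟨b, h'⟩

theorem ext_mem {f g : α ≃. β} (h : ∀ a b, b ∈ f a ↔ b ∈ g a) : f = g :=
  PEquiv.ext fun a => Option.ext fun b => h a b

variable {k : Type*} [Field k]

/-- The function on `β` obtained by transport of a function along a partial equivalence, with the
value `0` where there is no preimage. -/
def push (f : α ≃. β) (x : α → k) (b : β) : k := (f.symm b).elim 0 x

theorem push_of_mem {f : α ≃. β} {a : α} {b : β} (h : b ∈ f a) (x : α → k) :
    f.push x b = x a := by
  rw [push, (f.eq_some_iff).2 h, Option.elim_some]

theorem push_of_forall_notMem {f : α ≃. β} {b : β} (h : ∀ a, b ∉ f a) (x : α → k) :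
    f.push x b = 0 := by
  rw [push, Option.eq_none_iff_forall_not_mem.2 fun a ha => h a (f.mem_iff_mem.1 ha),
    Option.elim_none]

theorem push_trans (f : α ≃. β) (g : β ≃. γ) (x : α → k) :
    (f.trans g).push x = g.push (f.push x) := by
  ext c
  by_cases hc : ∃ b, c ∈ g b
  · obtain ⟨b, hb⟩ := hc
    rw [push_of_mem hb]
    by_cases hf : ∃ a, b ∈ f a
    · obtain ⟨a, ha⟩ := hf
      rw [push_of_mem ha, push_of_mem ((f.mem_trans g a c).2 ⟨b, ha, hb⟩)]
    · push Not at hf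
      rw [push_of_forall_notMem hf, push_of_forall_notMem]
      intro a ha
      obtain ⟨b', hb', hc'⟩ := (f.mem_trans g a c).1 ha
      exact hf a (g.inj hb hc' ▸ hb')
  · push Not at hc
    rw [push_of_forall_notMem hc, push_of_forall_notMem]
    intro a ha
    obtain ⟨b, -, hb⟩ := (f.mem_trans g a c).1 ha
    exact hc b hb

variable (k) in
/-- `PEquiv.push`, as a linear map. -/
def pushEnd (f : α ≃. α) : Module.End k (α → k) where
  toFun := f.push
  map_add' x y := by
    ext b
    simp only [push, Pi.add_apply]
    cases f.symm b <;> simp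
  map_smul' c x := by
    ext b
    simp only [push, Pi.smul_apply, RingHom.id_apply]
    cases f.symm b <;> simp

/-- Operators compose from right to left and `PEquiv.trans` from left to right, so the factors
change order. -/
theorem pushEnd_mul (f g : α ≃. α) : pushEnd k g * pushEnd k f = pushEnd k (f.trans g) :=
  LinearMap.ext fun x => (push_trans f g x).symm

end PEquiv

/-! ### The action of the edges on the entry paths -/

namespace DirGraph.EntryPaths

variable {V Ed : Type*} {E : DirGraph V Ed} {H : Set V}

/-- `Step e`, as a partial equivalence. -/
def stepEquiv (hH : E.IsHereditary H) (e : Ed) : E.EntryPaths H ≃. E.EntryPaths H :=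
  PEquiv.ofRel (Step e) (fun _ _ _ => Step.left_unique) (fun _ _ _ => Step.right_unique hH)

variable (E H) in
/-- The partial identity on the paths with source `u`. -/
def sourceEquiv (u : V) : E.EntryPaths H ≃. E.EntryPaths H :=
  PEquiv.ofRel (fun α β => α = β ∧ α.1.source = u) (fun _ _ _ h h' => h.1.trans h'.1.symm)
    (fun _ _ _ h h' => h.1.symm.trans h'.1)

variable {hH : E.IsHereditary H} {e f : Ed} {u w : V} {α β : E.EntryPaths H}

theorem mem_stepEquiv : β ∈ stepEquiv hH e α ↔ Step e α β := PEquiv.mem_ofRel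

theorem mem_stepEquiv_symm : α ∈ (stepEquiv hH e).symm β ↔ Step e α β :=
  (stepEquiv hH e).mem_iff_mem.trans mem_stepEquiv

theorem mem_sourceEquiv : β ∈ sourceEquiv E H u α ↔ α = β ∧ α.1.source = u := PEquiv.mem_ofRel

theorem sourceEquiv_symm : (sourceEquiv E H u).symm = sourceEquiv E H u :=
  PEquiv.ext_mem fun α β => by
    rw [PEquiv.mem_iff_mem, mem_sourceEquiv, mem_sourceEquiv]
    constructor <;> rintro ⟨rfl, h⟩ <;> exact ⟨rfl, h⟩

theorem sourceEquiv_trans_self :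
    (sourceEquiv E H u).trans (sourceEquiv E H u) = sourceEquiv E H u :=
  PEquiv.ext_mem fun α β => by
    simp only [PEquiv.mem_trans, mem_sourceEquiv]
    constructor
    · rintro ⟨_, ⟨rfl, h⟩, h'⟩; exact h'
    · rintro ⟨rfl, h⟩; exact ⟨α, ⟨rfl, h⟩, rfl, h⟩

theorem sourceEquiv_trans_of_ne (h : u ≠ w) :
    (sourceEquiv E H u).trans (sourceEquiv E H w) = ⊥ :=
  PEquiv.ext_mem fun α β => by
    simp only [PEquiv.mem_trans, mem_sourceEquiv, PEquiv.bot_apply, Option.not_mem_none, iff_false]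
    rintro ⟨_, ⟨rfl, h1⟩, -, h2⟩
    exact h (h1.symm.trans h2)

theorem stepEquiv_trans_sourceEquiv :
    (stepEquiv hH e).trans (sourceEquiv E H (E.s e)) = stepEquiv hH e :=
  PEquiv.ext_mem fun α β => by
    simp only [PEquiv.mem_trans, mem_sourceEquiv, mem_stepEquiv]
    constructor
    · rintro ⟨_, h, rfl, -⟩; exact h
    · intro h; exact ⟨β, h, rfl, h.2.1⟩

theorem sourceEquiv_trans_stepEquiv :
    (sourceEquiv E H (E.r e)).trans (stepEquiv hH e) = stepEquiv hH e :=
  PEquiv.ext_mem fun α β => by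
    simp only [PEquiv.mem_trans, mem_sourceEquiv, mem_stepEquiv]
    constructor
    · rintro ⟨_, ⟨rfl, -⟩, h⟩; exact h
    · intro h; exact ⟨α, ⟨rfl, h.1⟩, h⟩

theorem stepEquiv_trans_symm :
    (stepEquiv hH e).trans (stepEquiv hH e).symm = sourceEquiv E H (E.r e) :=
  PEquiv.ext_mem fun α β => by
    simp only [PEquiv.mem_trans, mem_sourceEquiv, mem_stepEquiv, mem_stepEquiv_symm]
    constructor
    · rintro ⟨_, h, h'⟩; exact ⟨h.left_unique h', h.1⟩
    · rintro ⟨rfl, h⟩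
      obtain ⟨γ, hγ⟩ := exists_step e α h
      exact ⟨γ, hγ, hγ⟩

theorem stepEquiv_trans_symm_of_ne (hb : ∀ w ∈ H, ¬ E.IsBifurcation w) (h : e ≠ f) :
    (stepEquiv hH f).trans (stepEquiv hH e).symm = ⊥ :=
  PEquiv.ext_mem fun α β => by
    simp only [PEquiv.mem_trans, mem_stepEquiv, mem_stepEquiv_symm, PEquiv.bot_apply,
      Option.not_mem_none, iff_false]
    rintro ⟨_, h1, h2⟩
    exact h (h2.edge_unique hb h1)

theorem mem_symm_trans_stepEquiv :
    β ∈ (stepEquiv hH e).symm.trans (stepEquiv hH e) α ↔ α = β ∧ ∃ γ, Step e γ α := by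
  simp only [PEquiv.mem_trans, mem_stepEquiv, mem_stepEquiv_symm]
  constructor
  · rintro ⟨γ, h, h'⟩; exact ⟨h.right_unique hH h', γ, h⟩
  · rintro ⟨rfl, γ, h⟩; exact ⟨γ, h, h⟩

/-- A nonempty path comes from its own first edge; a vertex of `H` comes from any edge that it
emits. -/
theorem exists_step_of_source {F : Finset Ed} (hH : E.IsHereditary H) (hne : F.Nonempty)
    (hF : ∀ e, e ∈ F ↔ E.s e = u) (h : β.1.source = u) : ∃ e ∈ F, ∃ γ, Step e γ β := by
  rcases hβ : β.1.edges with _ | ⟨f, l⟩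
  · obtain ⟨e, he⟩ := hne
    exact ⟨e, he, exists_step_of_nil hH hβ (((hF e).1 he).trans h.symm)⟩
  · obtain ⟨γ, hγ, -⟩ := exists_step_of_cons hβ
    exact ⟨f, (hF f).2 (hγ.2.1.symm.trans h), γ, hγ⟩

/-- The summation relation in the representation: the paths with source `u` are the disjoint union
of the ranges of the edges at `u`, by `exists_step_of_source` and `Step.edge_unique`. -/
theorem sum_push {k : Type*} [Field k] (hb : ∀ w ∈ H, ¬ E.IsBifurcation w) {F : Finset Ed}
    (hne : F.Nonempty) (hF : ∀ e, e ∈ F ↔ E.s e = u) (x : E.EntryPaths H → k) :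
    (sourceEquiv E H u).push x =
      ∑ e ∈ F, (stepEquiv hH e).push ((stepEquiv hH e).symm.push x) := by
  ext β
  simp only [← PEquiv.push_trans, Finset.sum_apply]
  by_cases h : β.1.source = u
  · obtain ⟨e, he, γ, hγ⟩ := exists_step_of_source hH hne hF h
    rw [PEquiv.push_of_mem (mem_sourceEquiv.2 ⟨rfl, h⟩), Finset.sum_eq_single_of_mem e he,
      PEquiv.push_of_mem (mem_symm_trans_stepEquiv.2 ⟨rfl, γ, hγ⟩)]
    intro f _ hf
    refine PEquiv.push_of_forall_notMem (fun α hα => hf ?_) x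
    obtain ⟨rfl, γ', hγ'⟩ := mem_symm_trans_stepEquiv.1 hα
    exact hγ'.edge_unique hb hγ
  · rw [PEquiv.push_of_forall_notMem, Finset.sum_eq_zero]
    · refine fun f hf => PEquiv.push_of_forall_notMem (fun α hα => h ?_) x
      obtain ⟨rfl, γ', hγ'⟩ := mem_symm_trans_stepEquiv.1 hα
      exact hγ'.2.1.trans ((hF f).1 hf)
    · intro α hα
      obtain ⟨rfl, h'⟩ := mem_sourceEquiv.1 hα
      exact h h'

end DirGraph.EntryPaths

/-! ### The ideal of a line point in the Leavitt path algebra -/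

namespace LPA

open DirGraph EntryPaths PEquiv

variable (k : Type*) [Field k] {V Ed : Type*} {E : DirGraph V Ed}

/-- The partial injections of the entry paths define a representation on all functions with values
in `k`, in which `p_w` keeps the value of the constant function `1` at the path `w`. Only heredity
and the absence of bifurcations enter. -/
theorem p_ne_zero_of_mem {H : Set V} (hH : E.IsHereditary H)
    (hb : ∀ w ∈ H, ¬ E.IsBifurcation w) {w : V} (hw : w ∈ H) : p k E w ≠ 0 := by
  intro h0
  obtain ⟨φ, ⟨hp, -, -⟩, -⟩ := existsUnique_lift k E
    (fun u => pushEnd k (sourceEquiv E H u)) (fun e => pushEnd k (stepEquiv hH e))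
    (fun e => pushEnd k (stepEquiv hH e).symm)
    (fun u => by rw [pushEnd_mul, sourceEquiv_trans_self])
    (fun u w h => by rw [pushEnd_mul, sourceEquiv_trans_of_ne h.symm]; rfl)
    (fun e => by rw [pushEnd_mul, stepEquiv_trans_sourceEquiv])
    (fun e => by rw [pushEnd_mul, sourceEquiv_trans_stepEquiv])
    (fun e => by
      rw [pushEnd_mul, ← sourceEquiv_symm, ← PEquiv.symm_trans_rev, sourceEquiv_trans_stepEquiv])
    (fun e => by
      rw [pushEnd_mul, ← sourceEquiv_symm, ← PEquiv.symm_trans_rev, stepEquiv_trans_sourceEquiv])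
    (fun e => by rw [pushEnd_mul, stepEquiv_trans_symm])
    (fun e f h => by rw [pushEnd_mul, stepEquiv_trans_symm_of_ne hb h]; rfl)
    (fun u F hne hF => LinearMap.ext fun x => by
      rw [LinearMap.sum_apply]
      exact sum_push hb hne hF x)
  have h1 : (sourceEquiv E H w).push (fun _ => (1 : k)) (vertex w hw) = 1 :=
    push_of_mem (mem_sourceEquiv.2 ⟨rfl, rfl⟩) _
  have h2 : pushEnd k (sourceEquiv E H w) = 0 := by rw [← hp w, h0, map_zero]
  have h3 : (sourceEquiv E H w).push (fun _ => (1 : k)) = 0 := LinearMap.congr_fun h2 _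
  rw [h3] at h1
  exact zero_ne_one h1

end LPA

/-! ### Matrix units -/

namespace FinMatrix

variable {Λ k : Type*} [Field k]

/-- The matrix with the entry `c` at the place `(i, j)` and zeros elsewhere. -/
def single (i j : Λ) (c : k) : FinMatrix Λ k := (Finsupp.single (i, j) c : Λ × Λ →₀ k)

theorem entry_single [DecidableEq Λ] (i j i' j' : Λ) (c : k) :
    (single i j c).entry i' j' = if i = i' ∧ j = j' then c else 0 := by
  classical
  rw [entry, single]
  exact (Finsupp.single_apply).trans (by simp [Prod.ext_iff])

theorem induction_single {P : FinMatrix Λ k → Prop} (h0 : P 0)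
    (hadd : ∀ A B, P A → P B → P (A + B)) (hs : ∀ i j c, P (single i j c)) (A : FinMatrix Λ k) :
    P A :=
  Finsupp.induction_linear (motive := P) A h0 hadd fun x c => hs x.1 x.2 c

theorem single_mul_single (i j m : Λ) (c d : k) :
    single i j c * single j m d = single i m (c * d) := by
  classical
  ext i' m'
  rw [entry_mul_eq_sum _ _ _ _ (s := {j}) fun l hl => by
    rw [entry_single] at hl
    simp_all]
  simp only [Finset.sum_singleton, entry_single, and_true, true_and]
  split_ifs <;> simp_all

theorem single_mul_single_of_ne {i j l m : Λ} (h : j ≠ l) (c d : k) :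
    single i j c * single l m d = 0 := by
  classical
  ext i' m'
  rw [entry_mul_eq_sum _ _ _ _ (s := {j}) fun l hl => by
    rw [entry_single] at hl
    simp_all]
  simp [entry_single, h.symm]

theorem star_single [StarRing k] (i j : Λ) (c : k) :
    star (single i j c) = single j i (star c) := by
  classical
  ext i' j'
  simp only [entry_star, entry_single, and_comm]
  split_ifs <;> simp

end FinMatrix

/-! ### The isomorphism of the ideal with the finite matrices -/

namespace LPA

open DirGraph EntryPaths

variable {k : Type*} [Field k] [StarRing k] {V Ed : Type*} {E : DirGraph V Ed} {v : V}

variable (k E v) in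
/-- The linear map that takes the matrix units to the elements `u_α u_β^*`. -/
def ofMatrix : FinMatrix (E.EntryPaths (E.reach v)) k →ₗ[k] LPA k E :=
  Finsupp.linearCombination k fun x : E.EntryPaths (E.reach v) × E.EntryPaths (E.reach v) =>
    unitElt k x.1 * star (unitElt k x.2)

theorem ofMatrix_single (α β : E.EntryPaths (E.reach v)) (c : k) :
    ofMatrix k E v (FinMatrix.single α β c) = c • (unitElt k α * star (unitElt k β)) :=
  Finsupp.linearCombination_single _ _ _

theorem ofMatrix_mul (hv : E.IsLinePoint v) (A B : FinMatrix (E.EntryPaths (E.reach v)) k) :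
    ofMatrix k E v (A * B) = ofMatrix k E v A * ofMatrix k E v B := by
  induction A using FinMatrix.induction_single with
  | h0 => simp
  | hadd A A' h h' => rw [add_mul, map_add, map_add, add_mul, h, h']
  | hs i j c =>
    induction B using FinMatrix.induction_single with
    | h0 => simp
    | hadd B B' h h' => rw [mul_add, map_add, map_add, mul_add, h, h']
    | hs l m d =>
      rw [ofMatrix_single, ofMatrix_single, smul_mul_smul_comm, mul_assoc,
        ← mul_assoc (star (unitElt k j))]
      by_cases h : j = l
      · subst h
        rw [FinMatrix.single_mul_single, ofMatrix_single, star_unitElt_mul_self j hv,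
          ← mul_assoc, unitElt_mul_p]
      · rw [FinMatrix.single_mul_single_of_ne h, star_unitElt_mul_unitElt_of_ne hv h, zero_mul,
          mul_zero, smul_zero, map_zero]

theorem star_add_matrix (A B : FinMatrix (E.EntryPaths (E.reach v)) k) :
    star (A + B) = star A + star B := by
  ext i j
  simp [FinMatrix.entry_star]

theorem ofMatrix_star (A : FinMatrix (E.EntryPaths (E.reach v)) k) :
    ofMatrix k E v (star A) = star (ofMatrix k E v A) := by
  induction A using FinMatrix.induction_single with
  | h0 =>
    have : star (0 : FinMatrix (E.EntryPaths (E.reach v)) k) = 0 := by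
      ext i j
      simp [FinMatrix.entry_star]
    rw [this, map_zero, star_zero]
  | hadd A A' h h' => rw [star_add_matrix, map_add, map_add, star_add, h, h']
  | hs i j c =>
    rw [FinMatrix.star_single, ofMatrix_single, ofMatrix_single, star_smul, star_mul, star_star]

/-- Compression by the `u_α` reads off matrix entries. This gives injectivity here, and by density
it controls the closed ideal in the `C^*`-algebra. -/
theorem star_unitElt_mul_ofMatrix_mul (hv : E.IsLinePoint v) (α β : E.EntryPaths (E.reach v))
    (A : FinMatrix (E.EntryPaths (E.reach v)) k) :
    star (unitElt k α) * ofMatrix k E v A * unitElt k β = A.entry α β • p k E v := by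
  classical
  induction A using FinMatrix.induction_single with
  | h0 => simp
  | hadd A A' h h' => rw [map_add, mul_add, add_mul, h, h', FinMatrix.entry_add, add_smul]
  | hs i j c =>
    rw [ofMatrix_single, mul_smul_comm, smul_mul_assoc, ← mul_assoc, mul_assoc,
      FinMatrix.entry_single]
    by_cases hi : i = α
    · subst hi
      by_cases hj : j = β
      · subst hj
        simp [star_unitElt_mul_self, hv, p_mul_p]
      · simp [star_unitElt_mul_unitElt_of_ne hv hj, hj]
    · simp [star_unitElt_mul_unitElt_of_ne hv (Ne.symm hi), hi]

theorem ofMatrix_injective (hv : E.IsLinePoint v) : Function.Injective (ofMatrix k E v) := by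
  rw [injective_iff_map_eq_zero]
  intro A hA
  ext α β
  have := star_unitElt_mul_ofMatrix_mul hv α β A
  rw [hA, mul_zero, zero_mul] at this
  exact (smul_eq_zero.1 this.symm).resolve_right
    (p_ne_zero_of_mem k (isHereditary_reach v) hv.1 (mem_reach_self v))

theorem range_ofMatrix_eq_span : LinearMap.range (ofMatrix k E v) = Submodule.span k
    (Set.range fun x : E.EntryPaths (E.reach v) × E.EntryPaths (E.reach v) =>
      unitElt k x.1 * star (unitElt k x.2)) :=
  Finsupp.range_linearCombination _

theorem mul_ofMatrix_mem (hv : E.IsLinePoint v) (a : LPA k E) {x : LPA k E}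
    (hx : x ∈ LinearMap.range (ofMatrix k E v)) : a * x ∈ LinearMap.range (ofMatrix k E v) := by
  have hE (α β : E.EntryPaths (E.reach v)) :
      unitElt k α * star (unitElt k β) ∈ LinearMap.range (ofMatrix k E v) :=
    ⟨FinMatrix.single α β 1, by rw [ofMatrix_single, one_smul]⟩
  -- It suffices that `a` maps the set of all `u_α` into itself together with `0`; each generator
  -- does.
  have hgen {a : LPA k E} (ha : ∀ α : E.EntryPaths (E.reach v),
      a * unitElt k α = 0 ∨ ∃ β : E.EntryPaths (E.reach v), a * unitElt k α = unitElt k β)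
      {x : LPA k E} (hx : x ∈ LinearMap.range (ofMatrix k E v)) :
      a * x ∈ LinearMap.range (ofMatrix k E v) := by
    rw [range_ofMatrix_eq_span] at hx
    induction hx using Submodule.span_induction with
    | mem x hx =>
      obtain ⟨⟨α, β⟩, rfl⟩ := hx
      simp only [← mul_assoc]
      obtain h | ⟨γ, h⟩ := ha α
      · rw [h, zero_mul]
        exact zero_mem _
      · rw [h]
        exact hE _ _
    | zero => rw [mul_zero]; exact zero_mem _
    | add x y _ _ h h' => rw [mul_add]; exact add_mem h h'
    | smul c x _ h => rw [mul_smul_comm]; exact Submodule.smul_mem _ c h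
  induction a using LPA.induction generalizing x with
  | hp w =>
    refine hgen (fun α => ?_) hx
    by_cases h : w = α.1.source
    · exact Or.inr ⟨α, h ▸ p_mul_unitElt α⟩
    · exact Or.inl (p_mul_unitElt_of_ne h)
  | hs e =>
    refine hgen (fun α => ?_) hx
    by_cases h : α.1.source = E.r e
    · obtain ⟨β, hβ⟩ := exists_step e α h
      exact Or.inr ⟨β, s_mul_unitElt hv hβ⟩
    · exact Or.inl (s_mul_unitElt_of_ne (Ne.symm h))
  | hsStar e =>
    refine hgen (fun α => ?_) hx
    by_cases h : ∃ β, Step e β α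
    · obtain ⟨β, hβ⟩ := h
      exact Or.inr ⟨β, sStar_mul_unitElt hv hβ⟩
    · exact Or.inl (sStar_mul_unitElt_of_not_exists hv h)
  | hzero => rw [zero_mul]; exact zero_mem _
  | hadd a b ha hb => rw [add_mul]; exact add_mem (ha hx) (hb hx)
  | hmul a b ha hb => rw [mul_assoc]; exact ha (hb hx)
  | hsmul c a ha => rw [smul_mul_assoc]; exact Submodule.smul_mem _ c (ha hx)

theorem star_mem_range_ofMatrix {x : LPA k E} (hx : x ∈ LinearMap.range (ofMatrix k E v)) :
    star x ∈ LinearMap.range (ofMatrix k E v) := by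
  obtain ⟨A, rfl⟩ := hx
  exact ⟨star A, ofMatrix_star (k := k) A⟩

/-- The range is a left ideal closed under the involution, hence also a right ideal. -/
theorem isTwoSidedIdeal_range_ofMatrix (hv : E.IsLinePoint v) :
    IsTwoSidedIdeal k (LinearMap.range (ofMatrix k E v)) := by
  refine fun a x hx => ⟨mul_ofMatrix_mem hv a hx, ?_⟩
  have := star_mem_range_ofMatrix (mul_ofMatrix_mem hv (star a) (star_mem_range_ofMatrix hx))
  rwa [star_mul, star_star, star_star] at this

/-- The matrix unit equals `u_α p_v u_β^*`, and `p_v` is among the generators of the ideal. -/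
theorem unitElt_mul_star_mem (α β : E.EntryPaths (E.reach v)) :
    unitElt k α * star (unitElt k β) ∈ idealSpan k (p k E '' E.reach v) := by
  have h := isTwoSidedIdeal_idealSpan (k := k) (p k E '' E.reach v)
  rw [← unitElt_mul_p α]
  exact (h _ _ (h _ _ (subset_idealSpan _ ⟨v, mem_reach_self v, rfl⟩)).1).2

theorem range_ofMatrix (hv : E.IsLinePoint v) :
    LinearMap.range (ofMatrix k E v) = idealSpan k (p k E '' E.reach v) := by
  refine le_antisymm ?_ (idealSpan_le ?_ (isTwoSidedIdeal_range_ofMatrix hv))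
  · rw [range_ofMatrix_eq_span, Submodule.span_le]
    rintro _ ⟨⟨α, β⟩, rfl⟩
    exact unitElt_mul_star_mem α β
  · rintro _ ⟨w, hw, rfl⟩
    -- For the path `w` of length `0`, `u_w = t_w^*`, so the diagonal matrix unit is `t_w^* t_w =
    -- p_w`.
    refine ⟨FinMatrix.single (vertex w hw) (vertex w hw) 1, ?_⟩
    rw [ofMatrix_single, one_smul, unitElt_of_nil rfl, star_star]
    exact star_linkElt_mul_self hw

/-- The ideal of a line point is a full algebra of finite matrices. -/
def matrixEquiv (hv : E.IsLinePoint v) :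
    FinMatrix (E.EntryPaths (E.reach v)) k ≃⋆ₐ[k] vertexIdeal k E (E.reach v) where
  toEquiv := Equiv.ofBijective
    (fun A => ⟨ofMatrix k E v A, (range_ofMatrix (k := k) hv).le (LinearMap.mem_range_self _ A)⟩)
    ⟨fun A B h => ofMatrix_injective hv (congrArg Subtype.val h), fun x => by
      have hx : x.1 ∈ LinearMap.range (ofMatrix k E v) :=
        (range_ofMatrix (k := k) hv).ge x.2
      obtain ⟨A, hA⟩ := hx
      exact ⟨A, Subtype.ext hA⟩⟩
  map_add' A B := Subtype.ext (map_add (ofMatrix k E v) A B)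
  map_mul' A B := Subtype.ext (ofMatrix_mul hv A B)
  map_star' A := Subtype.ext (ofMatrix_star A)
  map_smul' c A := Subtype.ext (map_smul (ofMatrix k E v) c A)

end LPA

/-! ### Compact operators as limits of operators of finite rank -/

section CompactRankOne

open InnerProductSpace

variable {H : Type*} [NormedAddCommGroup H] [InnerProductSpace ℂ H]

theorem isCompactOperator_rankOne (x y : H) : IsCompactOperator (rankOne ℂ x y : H →L[ℂ] H) := by
  rw [rankOne_def']
  exact (isCompactOperator_of_locallyCompactSpace_rng
    (ContinuousLinearMap.toSpanSingleton ℂ x)).comp_clm (innerSL ℂ y)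

/-- A closed subspace that contains the operators of rank one contains the compact operators. -/
theorem IsCompactOperator.mem_of_rankOne_mem [CompleteSpace H] {W : Submodule ℂ (H →L[ℂ] H)}
    (hW : IsClosed (W : Set (H →L[ℂ] H))) (h : ∀ x y : H, rankOne ℂ x y ∈ W) {T : H →L[ℂ] H}
    (hT : IsCompactOperator T) : T ∈ W := by
  rw [← SetLike.mem_coe, ← hW.closure_eq, Metric.mem_closure_iff]
  intro ε hε
  have hK := ((isCompactOperator_iff_isCompact_closure_image_closedBall
    T.toLinearMap one_pos).1 hT).totallyBounded.subset subset_closure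
  obtain ⟨t, htf, ht⟩ := Metric.totallyBounded_iff.1 hK (ε / 2) (by positivity)
  -- With `U` spanned by a finite `ε / 2`-net of the image of the unit ball, the projection onto `U`
  -- composed with `T` has finite rank and is close to `T`.
  let U : Submodule ℂ H := Submodule.span ℂ t
  have : FiniteDimensional ℂ U := FiniteDimensional.span_of_finite ℂ htf
  refine ⟨U.starProjection * T, ?_, ?_⟩
  · rw [(stdOrthonormalBasis ℂ U).starProjection_eq_sum_rankOne, Finset.sum_mul]
    refine sum_mem fun i _ => ?_
    rw [ContinuousLinearMap.mul_def, rankOne_comp]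
    exact h _ _
  · rw [dist_eq_norm]
    refine lt_of_le_of_lt ?_ (half_lt_self hε)
    refine ContinuousLinearMap.opNorm_le_of_unit_norm (by positivity) fun x hx => ?_
    obtain ⟨c, hc, hd⟩ := Set.mem_iUnion₂.1 (ht ⟨x, by simp [hx], rfl⟩)
    -- The error at `x` is the part of `T x` orthogonal to `U`. Subtracting the net point `c ∈ U`
    -- does not change it, so it is bounded by the distance from `T x` to `c`.
    have hc' : Uᗮ.starProjection c = 0 := by
      rw [Submodule.starProjection_orthogonal_val,
        Submodule.starProjection_eq_self_iff.2 (Submodule.subset_span hc), sub_self]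
    have h1 : (T - U.starProjection * T) x = Uᗮ.starProjection (T x - c) := by
      rw [map_sub, hc', sub_zero, Submodule.starProjection_orthogonal_val]
      rfl
    rw [h1]
    refine (Submodule.norm_starProjection_apply_le _ _).trans ?_
    rw [← dist_eq_norm]
    exact (Metric.mem_ball.1 hd).le

end CompactRankOne

/-! ### Operators on `ℓ²` given by partial injections -/

section LpTwo

variable {α : Type*}

/-- The vectors of the standard orthonormal basis of `ℓ²`. -/
def lpUnit (a : α) : lp (fun _ : α => ℂ) 2 := open Classical in lp.single 2 a 1

theorem lpUnit_apply_self (a : α) : lpUnit a a = 1 := by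
  classical exact lp.single_apply_self 2 a 1

theorem lpUnit_apply_ne {a b : α} (h : b ≠ a) : lpUnit a b = 0 := by
  classical exact lp.single_apply_ne 2 a 1 h

theorem inner_lpUnit (a : α) (x : lp (fun _ : α => ℂ) 2) : inner ℂ (lpUnit a) x = x a := by
  classical
  rw [lpUnit, lp.inner_single_left]
  simp

theorem mem_of_lpUnit_mem {N : Submodule ℂ (lp (fun _ : α => ℂ) 2)}
    (hN : IsClosed (N : Set (lp (fun _ : α => ℂ) 2))) (h : ∀ a, lpUnit a ∈ N)
    (x : lp (fun _ : α => ℂ) 2) : x ∈ N := by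
  classical
  refine hN.mem_of_tendsto (lp.hasSum_single (by simp) x) (Filter.Eventually.of_forall fun s => ?_)
  refine N.sum_mem fun a _ => ?_
  have : lp.single 2 a (x a) = x a • lpUnit a := by
    rw [lpUnit, ← lp.single_smul, smul_eq_mul, mul_one]
  rw [this]
  exact N.smul_mem _ (h a)

/-- A closed subspace that contains the operators of rank one given by the standard basis contains
the compact operators. -/
theorem IsCompactOperator.mem_of_rankOne_lpUnit_mem
    {W : Submodule ℂ (lp (fun _ : α => ℂ) 2 →L[ℂ] lp (fun _ : α => ℂ) 2)}
    (hW : IsClosed (W : Set (lp (fun _ : α => ℂ) 2 →L[ℂ] lp (fun _ : α => ℂ) 2)))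
    (h : ∀ a b : α, InnerProductSpace.rankOne ℂ (lpUnit a) (lpUnit b) ∈ W)
    {T : lp (fun _ : α => ℂ) 2 →L[ℂ] lp (fun _ : α => ℂ) 2} (hT : IsCompactOperator T) :
    T ∈ W := by
  refine hT.mem_of_rankOne_mem hW fun x y => ?_
  -- Density of the span of the basis vectors is used in one variable at a time, since `rankOne` is
  -- linear in the first variable and conjugate-linear in the second.
  have h1 (b : α) : InnerProductSpace.rankOne ℂ x (lpUnit b) ∈ W := by
    let L := (InnerProductSpace.rankOne ℂ (E := lp (fun _ : α => ℂ) 2)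
      (F := lp (fun _ : α => ℂ) 2)).flip (lpUnit b)
    exact mem_of_lpUnit_mem (N := W.comap L.toLinearMap) (hW.preimage L.continuous)
      (fun a => h a b) x
  let L := InnerProductSpace.rankOne ℂ (F := lp (fun _ : α => ℂ) 2) x
  exact mem_of_lpUnit_mem (N := W.comap L.toLinearMap) (hW.preimage L.continuous) h1 y

namespace PEquiv

/-- The witness is the preimage of `s`. Points without a preimage contribute `0 ^ r`, which vanishes
because `r ≠ 0`. Comparing finite partial sums in this way shows that `push` preserves `ℓ²` and is
contractive. -/
theorem exists_sum_push_eq (f : α ≃. α) (x : α → ℂ) (s : Finset α) {r : ℝ} (hr : r ≠ 0) :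
    ∃ t : Finset α, ∑ b ∈ s, ‖f.push x b‖ ^ r = ∑ a ∈ t, ‖x a‖ ^ r := by
  classical
  refine ⟨s.biUnion fun b => (f.symm b).toFinset, ?_⟩
  rw [Finset.sum_biUnion]
  · refine Finset.sum_congr rfl fun b _ => ?_
    rw [push]
    cases f.symm b <;> simp [Real.zero_rpow hr]
  · intro b _ c _ hbc
    refine Finset.disjoint_left.2 fun a hb hc => hbc ?_
    exact f.symm.inj (Option.mem_toFinset.1 hb) (Option.mem_toFinset.1 hc)

theorem sum_push_le (f : α ≃. α) (x : lp (fun _ : α => ℂ) 2) (s : Finset α) :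
    ∑ b ∈ s, ‖f.push x b‖ ^ (2 : ENNReal).toReal ≤ ‖x‖ ^ (2 : ENNReal).toReal := by
  obtain ⟨t, ht⟩ := f.exists_sum_push_eq x s (r := (2 : ENNReal).toReal) (by simp)
  rw [ht]
  exact lp.sum_rpow_le_norm_rpow (by simp) x t

/-- `PEquiv.push`, as an operator on `ℓ²`. -/
def pushL (f : α ≃. α) : lp (fun _ : α => ℂ) 2 →L[ℂ] lp (fun _ : α => ℂ) 2 :=
  LinearMap.mkContinuous
    { toFun := fun x => ⟨f.push x, memℓp_gen' (f.sum_push_le x)⟩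
      map_add' := fun x y => lp.ext ((pushEnd ℂ f).map_add x y)
      map_smul' := fun c x => lp.ext ((pushEnd ℂ f).map_smul c x) } 1 fun x => by
    rw [one_mul]
    exact lp.norm_le_of_forall_sum_le (by simp) (norm_nonneg x) (f.sum_push_le x)

theorem coe_pushL (f : α ≃. α) (x : lp (fun _ : α => ℂ) 2) : ⇑(f.pushL x) = f.push x := rfl

theorem pushL_mul (f g : α ≃. α) : pushL g * pushL f = pushL (f.trans g) :=
  ContinuousLinearMap.ext fun x => lp.ext (push_trans f g x).symm

theorem pushL_bot : pushL (⊥ : α ≃. α) = 0 := rfl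

theorem pushL_lpUnit {f : α ≃. α} {a b : α} (h : b ∈ f a) : f.pushL (lpUnit a) = lpUnit b := by
  refine lp.ext (funext fun c => ?_)
  rw [coe_pushL]
  by_cases hc : c = b
  · rw [hc, push_of_mem h, lpUnit_apply_self, lpUnit_apply_self]
  · rw [lpUnit_apply_ne hc, push]
    rcases hd : f.symm c with _ | d
    · rfl
    · refine lpUnit_apply_ne fun hda => hc ?_
      have := f.eq_some_iff.1 hd
      rw [hda] at this
      exact Option.mem_unique this h

theorem pushL_lpUnit_of_forall_notMem {f : α ≃. α} {a : α} (h : ∀ b, b ∉ f a) :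
    f.pushL (lpUnit a) = 0 := by
  refine lp.ext (funext fun c => ?_)
  rw [coe_pushL, push]
  rcases hd : f.symm c with _ | d
  · rfl
  · refine lpUnit_apply_ne fun hda => h c ?_
    exact hda ▸ f.eq_some_iff.1 hd

/-- Coordinates are inner products with basis vectors, so it is enough to know that `pushL f` maps
basis vectors to basis vectors along `f`, or to `0`. -/
theorem star_pushL (f : α ≃. α) : star (pushL f) = pushL f.symm := by
  refine ContinuousLinearMap.ext fun x => lp.ext (funext fun a => ?_)
  rw [← inner_lpUnit, ContinuousLinearMap.star_eq_adjoint, ContinuousLinearMap.adjoint_inner_right,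
    coe_pushL]
  by_cases h : ∃ b, b ∈ f a
  · obtain ⟨b, h⟩ := h
    rw [pushL_lpUnit h, inner_lpUnit, push_of_mem (f.mem_iff_mem.2 h)]
  · push Not at h
    rw [pushL_lpUnit_of_forall_notMem h, inner_zero_left, push_of_forall_notMem]
    exact fun b hb => h b (f.mem_iff_mem.1 hb)

end PEquiv

end LpTwo

/-! ### The ideal of a line point in the graph `C^*`-algebra -/

namespace GraphCStar

open DirGraph EntryPaths PEquiv

variable {V Ed : Type*} {E : DirGraph V Ed}

/-- The identities of partial injections behind `LPA.p_ne_zero_of_mem` serve again, the adjoint now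
being the inverse partial injection. -/
theorem isCuntzKriegerFamily_pushL {H : Set V} (hH : E.IsHereditary H)
    (hb : ∀ w ∈ H, ¬ E.IsBifurcation w) :
    IsCuntzKriegerFamily E (fun u => pushL (sourceEquiv E H u))
      (fun e => pushL (stepEquiv hH e)) where
  star_proj u := by rw [star_pushL, sourceEquiv_symm]
  idem u := by rw [pushL_mul, sourceEquiv_trans_self]
  orth u w h := by rw [pushL_mul, sourceEquiv_trans_of_ne h.symm, pushL_bot]
  isometry e := by
    rw [mul_assoc, star_pushL, pushL_mul, stepEquiv_trans_symm, pushL_mul,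
      sourceEquiv_trans_stepEquiv]
  orth_range e f h := by
    rw [mul_assoc, ← mul_assoc (star _), star_pushL, pushL_mul (stepEquiv hH f),
      stepEquiv_trans_symm_of_ne hb h, pushL_bot, zero_mul, mul_zero]
  star_mul_self e := by rw [star_pushL, pushL_mul, stepEquiv_trans_symm]
  range_le e := by rw [← mul_assoc, pushL_mul, stepEquiv_trans_sourceEquiv]
  sum u F hne hF := by
    refine ContinuousLinearMap.ext fun x => lp.ext ?_
    refine (sum_push (hH := hH) hb hne hF x).trans ?_
    rw [sum_apply, lp.coeFn_sum]
    simp only [star_pushL]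
    rfl

/-- The canonical map from `L_ℂ(E)`, as a `*`-homomorphism. -/
def ofLPA : LPA ℂ E →⋆ₙₐ[ℂ] GraphCStar E where
  toFun := of E
  map_smul' c x := map_smul (of E) c x
  map_zero' := map_zero (of E)
  map_add' x y := map_add (of E) x y
  map_mul' x y := of_mul E x y
  map_star' x := of_star E x

theorem ofLPA_p (w : V) : ofLPA (LPA.p ℂ E w) = p E w := rfl

theorem ofLPA_s (e : Ed) : ofLPA (LPA.s ℂ E e) = s E e := rfl

/-- The representation on `ℓ²` of the entry paths. -/
def entryRep {H : Set V} (hH : E.IsHereditary H) (hb : ∀ w ∈ H, ¬ E.IsBifurcation w) :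
    GraphCStar E →⋆ₙₐ[ℂ]
      (lp (fun _ : E.EntryPaths H => ℂ) 2 →L[ℂ] lp (fun _ : E.EntryPaths H => ℂ) 2) :=
  (existsUnique_lift E (isCuntzKriegerFamily_pushL hH hb)).exists.choose

/-! ### Path elements acting on the standard basis -/

section Rep

variable {H : Set V} {hH : E.IsHereditary H} {hb : ∀ w ∈ H, ¬ E.IsBifurcation w}

theorem entryRep_p (w : V) : entryRep hH hb (p E w) = pushL (sourceEquiv E H w) :=
  (existsUnique_lift E (isCuntzKriegerFamily_pushL hH hb)).exists.choose_spec.1 w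

theorem entryRep_s (e : Ed) : entryRep hH hb (s E e) = pushL (stepEquiv hH e) :=
  (existsUnique_lift E (isCuntzKriegerFamily_pushL hH hb)).exists.choose_spec.2 e

theorem entryRep_p_lpUnit (α : E.EntryPaths H) :
    entryRep hH hb (p E α.1.source) (lpUnit α) = lpUnit α := by
  rw [entryRep_p]
  exact pushL_lpUnit (mem_sourceEquiv.2 ⟨rfl, rfl⟩)

theorem entryRep_s_lpUnit {e : Ed} {α β : E.EntryPaths H} (h : Step e α β) :
    entryRep hH hb (s E e) (lpUnit α) = lpUnit β := by
  rw [entryRep_s]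
  exact pushL_lpUnit (mem_stepEquiv.2 h)

theorem entryRep_star_s_lpUnit {e : Ed} {α β : E.EntryPaths H} (h : Step e α β) :
    entryRep hH hb (star (s E e)) (lpUnit β) = lpUnit α := by
  rw [map_star, entryRep_s, star_pushL]
  exact pushL_lpUnit (mem_stepEquiv_symm.2 h)

/-- The edges of `α` are prefixed one by one to the range of `α`, regarded as a path of length `0`.
-/
theorem entryRep_pathElt_lpUnit (α : E.EntryPaths H) {l : List Ed} (hl : α.1.edges = l) :
    entryRep hH hb (ofLPA (LPA.pathElt ℂ E α.1.source l)) (lpUnit (vertex α.1.range α.2.1)) =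
      lpUnit α := by
  induction l generalizing α with
  | nil =>
    obtain ⟨⟨w, l, h⟩, hα⟩ := α
    obtain rfl : l = [] := hl
    exact entryRep_p_lpUnit _
  | cons e l ih =>
    obtain ⟨β, hβ, hβl⟩ := exists_step_of_cons hl
    have hr : β.1.range = α.1.range := by
      rw [FinPath.range, FinPath.range, hl, hβl, hβ.1]
      rfl
    have := ih β hβl
    simp only [hr, hβ.1] at this
    rw [LPA.pathElt, map_mul, map_mul, mul_apply_eq_comp, this, ofLPA_s, entryRep_s_lpUnit hβ]

/-- Inside `H` the adjoint of an edge moves the basis vector of its source to that of its range,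
both paths of length `0`; so the adjoint path element follows the path forwards. -/
theorem entryRep_star_pathElt_lpUnit {w x : V} (hw : w ∈ H) (hx : x ∈ H) {l : List Ed}
    (hl : E.IsPathFrom w l) (h : E.endVertex w l = x) :
    entryRep hH hb (ofLPA (star (LPA.pathElt ℂ E w l))) (lpUnit (vertex w hw)) =
      lpUnit (vertex x hx) := by
  induction l generalizing w with
  | nil =>
    obtain rfl : w = x := h
    rw [LPA.pathElt, LPA.star_p]
    exact entryRep_p_lpUnit (vertex w hw)
  | cons e l ih =>
    obtain ⟨he, hl⟩ := hl
    subst he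
    have hs : Step e (vertex (E := E) (E.r e) (hH e hw)) (vertex (E.s e) hw) :=
      ⟨rfl, rfl, Or.inr ⟨rfl, rfl⟩⟩
    rw [LPA.pathElt, star_mul, map_mul, map_mul, mul_apply_eq_comp,
      map_star ofLPA (LPA.s ℂ E e), ofLPA_s, entryRep_star_s_lpUnit hs]
    exact ih _ hl h

end Rep

/-! ### The closed ideal and its representation by compact operators -/

variable {v : V}

/-- The representation on `ℓ²` of the entry paths of a line point. -/
def lineRep (hv : E.IsLinePoint v) : GraphCStar E →⋆ₙₐ[ℂ]
    (lp (fun _ : E.EntryPaths (E.reach v) => ℂ) 2 →L[ℂ]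
      lp (fun _ : E.EntryPaths (E.reach v) => ℂ) 2) :=
  entryRep (isHereditary_reach v) hv.1

variable (hv : E.IsLinePoint v)

/-- The factor `t^*` moves the basis vector of `v` to that of the range of `α`, and `s_α` then
builds up `α`. -/
theorem lineRep_unitElt_lpUnit (α : E.EntryPaths (E.reach v)) :
    lineRep hv (ofLPA (LPA.unitElt ℂ α)) (lpUnit (vertex v (mem_reach_self v))) = lpUnit α := by
  have hc := (mem_reach_iff.1 α.2.1).choose_spec
  have h : lineRep hv (ofLPA (star (LPA.linkElt ℂ v α.1.range α.2.1)))
      (lpUnit (vertex v (mem_reach_self v))) = lpUnit (vertex α.1.range α.2.1) :=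
    entryRep_star_pathElt_lpUnit _ _ hc.1 hc.2
  rw [LPA.unitElt, map_mul, map_mul, mul_apply_eq_comp, h]
  exact entryRep_pathElt_lpUnit α rfl

/-- As `v ∈ T(v)`, the only entry path with source `v` is `v` itself, so `p_v` acts as a projection
of rank one. -/
theorem lineRep_p_apply (x : lp (fun _ : E.EntryPaths (E.reach v) => ℂ) 2) :
    lineRep hv (p E v) x =
      x (vertex v (mem_reach_self v)) • lpUnit (vertex v (mem_reach_self v)) := by
  rw [lineRep, entryRep_p]
  refine lp.ext (funext fun β => ?_)
  rw [coe_pushL, lp.coeFn_smul, Pi.smul_apply, smul_eq_mul]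
  by_cases h : β.1.source = v
  · have hβ : β = vertex v (mem_reach_self v) := EntryPaths.ext h
      ((isHereditary_reach v).edges_eq_nil β (h.symm ▸ mem_reach_self v))
    rw [push_of_mem (mem_sourceEquiv.2 ⟨rfl, h⟩), hβ, lpUnit_apply_self, mul_one]
  · rw [lpUnit_apply_ne fun hβ => h (congrArg (fun γ => γ.1.source) hβ), mul_zero,
      push_of_forall_notMem]
    intro α hα
    obtain ⟨rfl, h'⟩ := mem_sourceEquiv.1 hα
    exact h h'

theorem lineRep_p_ne_zero : lineRep hv (p E v) ≠ 0 := by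
  intro h
  have h1 := lineRep_p_apply hv (lpUnit (vertex v (mem_reach_self v)))
  rw [h, lpUnit_apply_self, one_smul] at h1
  have h2 := congrArg (fun x => x (vertex v (mem_reach_self v))) h1
  exact zero_ne_one (h2.trans (lpUnit_apply_self _))

/-- The matrix units in `C^*(E)` act as the operators of rank one given by the standard basis. -/
theorem lineRep_unitElt_mul_star (α β : E.EntryPaths (E.reach v)) :
    lineRep hv (ofLPA (LPA.unitElt ℂ α * star (LPA.unitElt ℂ β))) =
      InnerProductSpace.rankOne ℂ (lpUnit α) (lpUnit β) := by
  refine ContinuousLinearMap.ext fun x => ?_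
  -- The inserted `p_v` turns `u_β^* x` into its coordinate at `v`, which is the inner product of
  -- `u_β δ_v = δ_β` with `x`; then `u_α δ_v = δ_α`.
  rw [← LPA.unitElt_mul_p α, map_mul, map_mul, map_mul, map_mul, map_star, map_star, ofLPA_p,
    mul_apply_eq_comp, mul_apply_eq_comp, lineRep_p_apply, map_smul,
    lineRep_unitElt_lpUnit, InnerProductSpace.rankOne_apply, ← inner_lpUnit,
    ContinuousLinearMap.star_eq_adjoint, ContinuousLinearMap.adjoint_inner_right,
    lineRep_unitElt_lpUnit]

/-- The span of the matrix units in `C^*(E)`. -/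
def matrixSpan (v : V) : Submodule ℂ (GraphCStar E) :=
  (LinearMap.range (LPA.ofMatrix ℂ E v)).map (of E)

/-- Joint use of the algebraic ideal property and continuity: density of `L_ℂ(E)` extends the
multiplier, and then closure extends the element of the span. -/
theorem isTwoSidedIdeal_closure_matrixSpan (hv : E.IsLinePoint v) :
    IsTwoSidedIdeal ℂ (matrixSpan (E := E) v).topologicalClosure := by
  have h0 (y : LPA ℂ E) {x : GraphCStar E} (hx : x ∈ matrixSpan v) :
      of E y * x ∈ matrixSpan v ∧ x * of E y ∈ matrixSpan v := by
    obtain ⟨x, hx, rfl⟩ := hx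
    have h := LPA.isTwoSidedIdeal_range_ofMatrix hv y x hx
    exact ⟨⟨_, h.1, of_mul E y x⟩, ⟨_, h.2, of_mul E x y⟩⟩
  have hc := (matrixSpan (E := E) v).isClosed_topologicalClosure
  have h1 (a : GraphCStar E) {x : GraphCStar E} (hx : x ∈ matrixSpan v) :
      a * x ∈ (matrixSpan v).topologicalClosure ∧ x * a ∈ (matrixSpan v).topologicalClosure := by
    induction a using GraphCStar.induction with
    | hP =>
      exact (hc.preimage (continuous_id.mul continuous_const)).inter
        (hc.preimage (continuous_const.mul continuous_id))
    | h y =>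
      exact ⟨Submodule.le_topologicalClosure _ (h0 y hx).1,
        Submodule.le_topologicalClosure _ (h0 y hx).2⟩
  intro a x hx
  exact closure_minimal (fun x hx => h1 a hx)
    ((hc.preimage (continuous_const.mul continuous_id)).inter
    (hc.preimage (continuous_id.mul continuous_const))) hx

/-- A closed property of the elements of the closed ideal of a line point has to be checked only on
the linear combinations of the matrix units. -/
theorem closedIdealSpan_induction (hv : E.IsLinePoint v) {P : GraphCStar E → Prop}
    (hP : IsClosed {x | P x}) (hzero : P 0) (hadd : ∀ x y, P x → P y → P (x + y))
    (hunit : ∀ (c : ℂ) (α β : E.EntryPaths (E.reach v)),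
      P (c • ofLPA (LPA.unitElt ℂ α * star (LPA.unitElt ℂ β))))
    {x : GraphCStar E} (hx : x ∈ closedIdealSpan (p E '' E.reach v)) : P x := by
  -- The closure is a closed ideal containing the generators, which already lie in the algebraic
  -- span; only this inclusion is needed.
  have h1 : closedIdealSpan (p E '' E.reach v) ≤ (matrixSpan v).topologicalClosure := by
    refine closedIdealSpan_le ?_ (isTwoSidedIdeal_closure_matrixSpan hv)
      (Submodule.isClosed_topologicalClosure _)
    rintro _ ⟨w, hw, rfl⟩
    refine Submodule.le_topologicalClosure _ ⟨LPA.p ℂ E w, ?_, rfl⟩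
    exact (LPA.range_ofMatrix (k := ℂ) hv).ge (subset_idealSpan _ ⟨w, hw, rfl⟩)
  refine closure_minimal ?_ hP (h1 hx)
  rintro _ ⟨_, ⟨A, rfl⟩, rfl⟩
  change P (ofLPA (LPA.ofMatrix ℂ E v A))
  induction A using FinMatrix.induction_single with
  | h0 => rw [map_zero, map_zero]; exact hzero
  | hadd A B hA hB => rw [map_add, map_add]; exact hadd _ _ hA hB
  | hs α β c => rw [LPA.ofMatrix_single, map_smul]; exact hunit c α β

theorem ofLPA_mem_closedIdealSpan {x : LPA ℂ E}
    (hx : x ∈ idealSpan ℂ (LPA.p ℂ E '' E.reach v)) :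
    ofLPA x ∈ closedIdealSpan (p E '' E.reach v) := by
  refine idealSpan_le (J := (closedIdealSpan (p E '' E.reach v)).comap (of E)) ?_ ?_ hx
  · rintro _ ⟨w, hw, rfl⟩
    exact subset_closedIdealSpan _ ⟨w, hw, rfl⟩
  · intro a y hy
    have h := isTwoSidedIdeal_closedIdealSpan (p E '' E.reach v) (of E a) (of E y) hy
    exact ⟨(congrArg (· ∈ closedIdealSpan _) (of_mul E a y)).mpr h.1,
      (congrArg (· ∈ closedIdealSpan _) (of_mul E y a)).mpr h.2⟩

/-- On the matrix span this is the reading off of entries; it passes to limits because the line `ℂ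
p_v` is finite-dimensional and hence closed. -/
theorem star_unitElt_mul_mul_mem (hv : E.IsLinePoint v) (α β : E.EntryPaths (E.reach v))
    {x : GraphCStar E} (hx : x ∈ closedIdealSpan (p E '' E.reach v)) :
    star (ofLPA (LPA.unitElt ℂ α)) * x * ofLPA (LPA.unitElt ℂ β) ∈ Submodule.span ℂ {p E v} := by
  refine closedIdealSpan_induction hv (P := fun x => star (ofLPA (LPA.unitElt ℂ α)) * x *
      ofLPA (LPA.unitElt ℂ β) ∈ Submodule.span ℂ {p E v})
    ?_ ?_ ?_ ?_ hx
  · exact (Submodule.closed_of_finiteDimensional (Submodule.span ℂ {p E v})).preimage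
      ((continuous_const.mul continuous_id).mul continuous_const)
  · rw [mul_zero, zero_mul]; exact zero_mem _
  · intro x y hx hy
    rw [mul_add, add_mul]; exact add_mem hx hy
  · intro c γ δ
    rw [← map_smul, ← LPA.ofMatrix_single, ← map_star, ← map_mul, ← map_mul,
      LPA.star_unitElt_mul_ofMatrix_mul hv, map_smul]
    exact Submodule.smul_mem _ _ (Submodule.mem_span_singleton_self _)

/-- The compression is `c p_v`, and its image `c • lineRep hv (p E v)` vanishes, which forces `c =
0`. -/
theorem star_unitElt_mul_mul_eq_zero (hv : E.IsLinePoint v) (α β : E.EntryPaths (E.reach v))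
    {x : GraphCStar E} (hx : x ∈ closedIdealSpan (p E '' E.reach v)) (h : lineRep hv x = 0) :
    star (ofLPA (LPA.unitElt ℂ α)) * x * ofLPA (LPA.unitElt ℂ β) = 0 := by
  obtain ⟨c, hc⟩ := Submodule.mem_span_singleton.1 (star_unitElt_mul_mul_mem hv α β hx)
  have h1 : lineRep hv (c • p E v) = 0 := by
    rw [hc, map_mul, map_mul, h, mul_zero, zero_mul]
  rw [map_smul] at h1
  rw [← hc, (smul_eq_zero.1 h1).resolve_right (lineRep_p_ne_zero hv), zero_smul]

/-- All compressions of `x` by the `u_α` vanish. Density, first on the left and then on the right,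
gives `y x z = 0` for all `y`, `z` in the ideal, in particular for `y = z = x^*`. -/
theorem eq_zero_of_lineRep_eq_zero (hv : E.IsLinePoint v) {x : GraphCStar E}
    (hx : x ∈ closedIdealSpan (p E '' E.reach v)) (h : lineRep hv x = 0) : x = 0 := by
  have h1 (β : E.EntryPaths (E.reach v)) {y : GraphCStar E}
      (hy : y ∈ closedIdealSpan (p E '' E.reach v)) : y * x * ofLPA (LPA.unitElt ℂ β) = 0 := by
    refine closedIdealSpan_induction hv (P := fun y => y * x * ofLPA (LPA.unitElt ℂ β) = 0)
      ?_ ?_ ?_ ?_ hy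
    · exact isClosed_eq ((continuous_id.mul continuous_const).mul continuous_const)
        continuous_const
    · rw [zero_mul, zero_mul]
    · intro y z hy hz
      rw [add_mul, add_mul, hy, hz, add_zero]
    · intro c γ δ
      rw [smul_mul_assoc, smul_mul_assoc, map_mul, map_star, mul_assoc, mul_assoc, ← mul_assoc _ x,
        star_unitElt_mul_mul_eq_zero hv δ β hx h, mul_zero, smul_zero]
  have h2 {y z : GraphCStar E} (hy : y ∈ closedIdealSpan (p E '' E.reach v))
      (hz : z ∈ closedIdealSpan (p E '' E.reach v)) : y * x * z = 0 := by
    refine closedIdealSpan_induction hv (P := fun z => y * x * z = 0)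
      ?_ ?_ ?_ ?_ hz
    · exact isClosed_eq (continuous_const.mul continuous_id) continuous_const
    · rw [mul_zero]
    · intro z w hz hw
      rw [mul_add, hz, hw, add_zero]
    · intro c γ δ
      rw [mul_smul_comm, map_mul, ← mul_assoc, h1 γ hy, zero_mul, smul_zero]
  have hs : star x ∈ closedIdealSpan (p E '' E.reach v) :=
    (vertexIdeal E (E.reach v)).star_mem' hx
  -- Two uses of the `C^*`-identity reduce `x = 0` to `x^* x x^* x = 0`.
  rw [← CStarRing.star_mul_self_eq_zero_iff, ← CStarRing.star_mul_self_eq_zero_iff, star_mul,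
    star_star, ← mul_assoc, h2 hs hs, zero_mul]

theorem isCompactOperator_lineRep (hv : E.IsLinePoint v) {x : GraphCStar E}
    (hx : x ∈ closedIdealSpan (p E '' E.reach v)) : IsCompactOperator (lineRep hv x) := by
  refine closedIdealSpan_induction hv (P := fun x => IsCompactOperator (lineRep hv x))
    ?_ ?_ ?_ ?_ hx
  · have hc : Continuous (lineRep hv) := AddMonoidHomClass.continuous_of_bound (lineRep hv) 1
      fun a => by
        rw [one_mul]
        exact NonUnitalStarAlgHom.norm_apply_le (lineRep hv) a
    exact isClosed_setOfPred_isCompactOperator.preimage hc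
  · rw [map_zero]; exact isCompactOperator_zero
  · intro x y hx hy
    rw [map_add]; exact hx.add hy
  · intro c α β
    rw [map_smul, lineRep_unitElt_mul_star]
    exact (isCompactOperator_rankOne _ _).smul c

/-- The representation of the closed ideal of a line point by compact operators. -/
def idealRep (hv : E.IsLinePoint v) : vertexIdeal E (E.reach v) →⋆ₙₐ[ℂ]
    compactOps (lp (fun _ : E.EntryPaths (E.reach v) => ℂ) 2) :=
  NonUnitalStarAlgHom.codRestrict
    ((lineRep hv).comp (NonUnitalStarSubalgebraClass.subtype (vertexIdeal E (E.reach v)))) _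
    fun x => isCompactOperator_lineRep hv x.2

theorem idealRep_injective (hv : E.IsLinePoint v) : Function.Injective (idealRep hv) := by
  rw [injective_iff_map_eq_zero]
  exact fun x hx => Subtype.ext (eq_zero_of_lineRep_eq_zero hv x.2 (congrArg Subtype.val hx))

/-- The range contains the rank one operators of the standard basis, and it is closed because an
injective `*`-homomorphism between `C^*`-algebras is isometric. -/
theorem idealRep_surjective (hv : E.IsLinePoint v) : Function.Surjective (idealRep hv) := by
  intro T
  let φ := (lineRep hv).comp (NonUnitalStarSubalgebraClass.subtype (vertexIdeal E (E.reach v)))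
  -- Closedness makes the ideal a `C^*`-algebra in its own right, as the isometry result requires.
  have hcl : IsClosed (vertexIdeal E (E.reach v) : Set (GraphCStar E)) :=
    isClosed_closedIdealSpan (p E '' E.reach v)
  have hφ : Function.Injective φ := fun x y h => idealRep_injective hv (Subtype.ext h)
  have hr : IsClosed (Set.range φ) :=
    (NonUnitalStarAlgHom.isometry φ hφ).isClosedEmbedding.isClosed_range
  let W : Submodule ℂ (lp (fun _ : E.EntryPaths (E.reach v) => ℂ) 2 →L[ℂ]
      lp (fun _ : E.EntryPaths (E.reach v) => ℂ) 2) :=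
    { carrier := Set.range φ
      zero_mem' := ⟨0, map_zero φ⟩
      add_mem' := by
        rintro _ _ ⟨x, rfl⟩ ⟨y, rfl⟩
        exact ⟨x + y, map_add φ x y⟩
      smul_mem' := by
        rintro c _ ⟨x, rfl⟩
        exact ⟨c • x, map_smul φ c x⟩ }
  obtain ⟨x, hx⟩ := T.2.mem_of_rankOne_lpUnit_mem (W := W) hr fun α β =>
      ⟨⟨ofLPA (LPA.unitElt ℂ α * star (LPA.unitElt ℂ β)),
        ofLPA_mem_closedIdealSpan (LPA.unitElt_mul_star_mem α β)⟩,
        lineRep_unitElt_mul_star hv α β⟩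
  exact ⟨x, Subtype.ext hx⟩

end GraphCStar

/-- Let `v` be a line point of the graph `E`. Then `T(v)` is hereditary, and with `Λ` the set of paths
that end in `T(v)` and whose last edge, if there is one, starts outside `T(v)`, the ideal `I_{T(v)}`
of `L_k(E)` is isomorphic to `M_Λ(k)` as a `*`-algebra over `k` (for every involution of the field
`k`, in particular for the trivial one), and the closed ideal of `C^*(E)` generated by `T(v)` is
isomorphic to the `C^*`-algebra of compact operators on `ℓ²(Λ)`. -/
theorem mainTheorem7 {V Ed k : Type*} [Field k] (E : DirGraph V Ed) (v : V)
    (hv : E.IsLinePoint v) :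
    E.IsHereditary (E.reach v) ∧
    (∀ [StarRing k], Nonempty
      (LPA.vertexIdeal k E (E.reach v) ≃⋆ₐ[k] FinMatrix (E.EntryPaths (E.reach v)) k)) ∧
    Nonempty (GraphCStar.vertexIdeal E (E.reach v) ≃⋆ₐ[ℂ]
      compactOps (lp (fun _ : E.EntryPaths (E.reach v) => ℂ) 2)) :=
  ⟨DirGraph.isHereditary_reach v, ⟨(LPA.matrixEquiv hv).symm⟩,
    ⟨StarAlgEquiv.ofBijective (GraphCStar.idealRep hv)
      ⟨GraphCStar.idealRep_injective hv, GraphCStar.idealRep_surjective hv⟩⟩⟩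

end
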